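/- Let $S=\{z\in\mathbb C:|z|=1\}$ and let $B=(S\times\{1\})\cup(\{1\}\times S)$ be the wedge of two circles, with base point $b_0=(1,1)$. Let $f:B\to B$ be the continuous map given by $$f(z,1)=\begin{cases}(z^4,1), & 0\le\arg z\le\frac{\pi}{2},\\ (1,z^4), & \frac{\pi}{2}\le\arg z\le\pi,\\ (z^{-4},1), & \pi\le\arg z\le\frac{3\pi}{2},\\ (1,z^{-4}), & \frac{3\pi}{2}\le\arg z\le 2\pi,\end{cases}\qquad f(1,t)=\begin{cases}(t^{-4},1), & 0\le\arg t\le\frac{\pi}{2},\\ (1,t^{-4}), & \frac{\pi}{2}\le\arg t\le\pi,\\ (t^{4},1), & \pi\le\arg t\le\frac{3\pi}{2},\\ (1,t^{4}), & \frac{3\pi}{2}\le\arg t\le 2\pi,\end{cases}$$ for $z,t\in S$, and let $P=\varprojlim\{B,f\}$ be the limit of the inverse sequence $B\xleftarrow{f}B\xleftarrow{f}B\xleftarrow{f}\cdots$. Then the compact metrizable space $P$ is not movable: for every topological embedding of $P$ onto a subset $X$ of the Hilbert cube $Q=[0,1]^{\mathbb N}$, it is not the case that every open neighbourhood $U$ of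 $X$ in $Q$ contains an open neighbourhood $V$ of $X$ such that for every open neighbourhood $W$ of $X$ there is a homotopy $F:V\times[0,1]\to U$ with $F(y,0)=y$ and $F(y,1)\in W$ for all $y\in V$. Moreover, the group $\pi_1(B,b_0)$ is free of rank two, the homomorphism $f_*:\pi_1(B,b_0)\to\pi_1(B,b_0)$ induced by $f$ is injective but not surjective, and the inverse sequence of groups $\pi_1(B,b_0)\xleftarrow{f_*}\pi_1(B,b_0)\xleftarrow{f_*}\cdots$ does not satisfy the Mittag-Leffler condition (for every index $n$ there is $m\ge n$ such that for all $k\ge m$ the images of the $k$-th and of the $m$-th group in the $n$-th group coincide). -/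

import Mathlib

open CategoryTheory

noncomputable section

/-! ### Movable compacta -/

/-- The Hilbert cube `[0,1]^ℕ`, with the product topology. -/
abbrev HilbertCube : Type := ℕ → unitInterval

/-- A subset `X` of the Hilbert cube is movable (in the cube) if every open neighbourhood `U` of
`X` contains an open neighbourhood `V` of `X` which can be deformed inside `U`, by a homotopy that
starts at the inclusion of `V`, into any prescribed open neighbourhood `W` of `X`. -/
def IsMovableInCube (X : Set HilbertCube) : Prop :=
  ∀ U : Set HilbertCube, IsOpen U → X ⊆ U →
    ∃ V : Set HilbertCube, IsOpen V ∧ X ⊆ V ∧ V ⊆ U ∧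
      ∀ W : Set HilbertCube, IsOpen W → X ⊆ W →
        ∃ F : C(V × unitInterval, U), ∀ y : V,
          (F (y, 0) : HilbertCube) = y ∧ (F (y, 1) : HilbertCube) ∈ W

/-- Borsuk's movability of a compact metrizable space: `X` has a copy in the Hilbert cube that is
movable there (this does not depend on the copy). -/
def IsMovable (X : Type*) [TopologicalSpace X] [CompactSpace X]
    [TopologicalSpace.MetrizableSpace X] : Prop :=
  ∃ e : X → HilbertCube, Topology.IsEmbedding e ∧ IsMovableInCube (Set.range e)

/-! ### The limit of an inverse sequence with one space and one bonding map -/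

/-- The limit of `X ← X ← X ← ⋯` with all bonding maps equal to `f`, as a subspace of the
countable power of `X`. -/
abbrev SequentialLimit {X : Type*} [TopologicalSpace X] (f : C(X, X)) : Type _ :=
  {x : ℕ → X // ∀ n, f (x (n + 1)) = x n}

instance SequentialLimit.instCompactSpace {X : Type*} [TopologicalSpace X] [CompactSpace X]
    [T2Space X] (f : C(X, X)) : CompactSpace (SequentialLimit f) := by
  have h : IsClosed {x : ℕ → X | ∀ n, f (x (n + 1)) = x n} := by
    rw [Set.ofPred_forall]
    exact isClosed_iInter fun n => isClosed_eq (by fun_prop) (by fun_prop)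
  exact isCompact_iff_compactSpace.mp h.isCompact

instance SequentialLimit.instMetrizableSpace {X : Type*} [TopologicalSpace X]
    [TopologicalSpace.MetrizableSpace X] (f : C(X, X)) :
    TopologicalSpace.MetrizableSpace (SequentialLimit f) := by
  have : TopologicalSpace.MetrizableSpace (ℕ → X) := by
    let := TopologicalSpace.metrizableSpaceMetric X
    let : MetricSpace (ℕ → X) := PiCountable.metricSpace
    infer_instance
  exact Topology.IsEmbedding.subtypeVal.metrizableSpace

/-! ### The wedge of two circles and its self-map -/

/-- The wedge `(S × {1}) ∪ ({1} × S)` of two unit circles. -/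
abbrev CircleWedge : Type := {p : Circle × Circle // p.2 = 1 ∨ p.1 = 1}

namespace CircleWedge

instance instCompactSpace : CompactSpace CircleWedge := by
  have h : IsClosed {p : Circle × Circle | p.2 = 1 ∨ p.1 = 1} :=
    (isClosed_eq continuous_snd continuous_const).union
      (isClosed_eq continuous_fst continuous_const)
  exact isCompact_iff_compactSpace.mp h.isCompact

/-- The base point `(1, 1)`. -/
def base : CircleWedge := ⟨(1, 1), Or.inl rfl⟩

/-- The first circle, `z ↦ (z, 1)`. -/
def inl (z : Circle) : CircleWedge := ⟨(z, 1), Or.inl rfl⟩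

/-- The second circle, `t ↦ (1, t)`. -/
def inr (t : Circle) : CircleWedge := ⟨(1, t), Or.inr rfl⟩

/-- The map on the circle that is `c₁`, `c₂`, `c₃`, `c₄` on the quarters with argument in
`[0, π/2]`, `[π/2, π]`, `[π, 3π/2]`, `[3π/2, 2π]`. A common end of two quarters is assigned to one
of them; the maps used below agree there. -/
def onQuarters (c₁ c₂ c₃ c₄ : Circle → CircleWedge) (z : Circle) : CircleWedge :=
  if 0 ≤ (z : ℂ).im then
    if 0 ≤ (z : ℂ).re then c₁ z else c₂ z
  else
    if (z : ℂ).re ≤ 0 then c₃ z else c₄ z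

open Classical in
/-- The self-map of the wedge, as a plain function: on the first circle it takes the values
`(z⁴, 1)`, `(1, z⁴)`, `(z⁻⁴, 1)`, `(1, z⁻⁴)` on the four successive quarters, and on the second
circle `(t⁻⁴, 1)`, `(1, t⁻⁴)`, `(t⁴, 1)`, `(1, t⁴)`. -/
def bondingFun (p : CircleWedge) : CircleWedge :=
  if p.1.2 = 1 then
    onQuarters (fun z => inl (z ^ 4)) (fun z => inr (z ^ 4))
      (fun z => inl (z ^ (-4 : ℤ))) (fun z => inr (z ^ (-4 : ℤ))) p.1.1
  else
    onQuarters (fun t => inl (t ^ (-4 : ℤ))) (fun t => inr (t ^ (-4 : ℤ)))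
      (fun t => inl (t ^ 4)) (fun t => inr (t ^ 4)) p.1.2

theorem continuous_inl : Continuous inl := by
  unfold inl; fun_prop

theorem continuous_inr : Continuous inr := by
  unfold inr; fun_prop

/-- On the axes the fourth power is `1`. -/
theorem pow_four_eq_one (z : Circle) (h : (z : ℂ).re = 0 ∨ (z : ℂ).im = 0) : z ^ 4 = 1 := by
  have hn : (z : ℂ).re * (z : ℂ).re + (z : ℂ).im * (z : ℂ).im = 1 := by
    rw [← Complex.normSq_apply]; exact Circle.normSq_coe z
  apply Circle.ext
  rw [Circle.coe_pow, Circle.coe_one]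
  have hz : (z : ℂ) = ⟨(z : ℂ).re, (z : ℂ).im⟩ := rfl
  generalize (z : ℂ).re = x at *
  generalize (z : ℂ).im = y at *
  rw [hz]
  rcases h with rfl | rfl
  · have h4 : y ^ 4 = 1 := by nlinarith
    apply Complex.ext <;> simp [pow_succ] <;> nlinarith
  · have h4 : x ^ 4 = 1 := by nlinarith
    apply Complex.ext <;> simp [pow_succ] <;> nlinarith

theorem continuous_onQuarters {c₁ c₂ c₃ c₄ : Circle → CircleWedge}
    (h₁ : Continuous c₁) (h₂ : Continuous c₂) (h₃ : Continuous c₃) (h₄ : Continuous c₄)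
    (h : ∀ z : Circle, z ^ 4 = 1 → c₁ z = base ∧ c₂ z = base ∧ c₃ z = base ∧ c₄ z = base) :
    Continuous (onQuarters c₁ c₂ c₃ c₄) := by
  have hre : Continuous fun z : Circle => (z : ℂ).re := by fun_prop
  have him : Continuous fun z : Circle => (z : ℂ).im := by fun_prop
  refine Continuous.if_le ?_ ?_ continuous_const him ?_
  · refine Continuous.if_le h₁ h₂ continuous_const hre fun z hz => ?_
    obtain ⟨e₁, e₂, -, -⟩ := h z (pow_four_eq_one z (Or.inl hz.symm))
    rw [e₁, e₂]
  · refine Continuous.if_le h₃ h₄ hre continuous_const fun z hz => ?_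
    obtain ⟨-, -, e₃, e₄⟩ := h z (pow_four_eq_one z (Or.inl hz))
    rw [e₃, e₄]
  · intro z hz
    obtain ⟨e₁, e₂, e₃, e₄⟩ := h z (pow_four_eq_one z (Or.inr hz.symm))
    simp only [e₁, e₂, e₃, e₄, ite_self]

theorem bondingFun_base : bondingFun base = base := by
  simp [bondingFun, onQuarters, base, inl]

theorem continuous_bondingFun : Continuous bondingFun := by
  have hl : Continuous (onQuarters (fun z => inl (z ^ 4)) (fun z => inr (z ^ 4))
      (fun z => inl (z ^ (-4 : ℤ))) (fun z => inr (z ^ (-4 : ℤ)))) := by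
    refine continuous_onQuarters (continuous_inl.comp (by fun_prop))
      (continuous_inr.comp (by fun_prop)) (continuous_inl.comp (continuous_zpow _))
      (continuous_inr.comp (continuous_zpow _)) fun z hz => ?_
    have hz' : z ^ (-4 : ℤ) = 1 := by
      rw [zpow_neg, inv_eq_one]; exact_mod_cast hz
    simp [hz, hz', inl, inr, base]
  have hr : Continuous (onQuarters (fun t => inl (t ^ (-4 : ℤ))) (fun t => inr (t ^ (-4 : ℤ)))
      (fun t => inl (t ^ 4)) (fun t => inr (t ^ 4))) := by
    refine continuous_onQuarters (continuous_inl.comp (continuous_zpow _))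
      (continuous_inr.comp (continuous_zpow _)) (continuous_inl.comp (by fun_prop))
      (continuous_inr.comp (by fun_prop)) fun z hz => ?_
    have hz' : z ^ (-4 : ℤ) = 1 := by
      rw [zpow_neg, inv_eq_one]; exact_mod_cast hz
    simp [hz, hz', inl, inr, base]
  have hA : IsClosed {p : CircleWedge | p.1.2 = 1} :=
    isClosed_eq (by fun_prop) continuous_const
  have hB : IsClosed {p : CircleWedge | p.1.1 = 1} :=
    isClosed_eq (by fun_prop) continuous_const
  have hcA : ContinuousOn bondingFun {p : CircleWedge | p.1.2 = 1} := by
    refine (hl.comp (continuous_fst.comp continuous_subtype_val)).continuousOn.congr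
      fun p hp => ?_
    exact if_pos hp
  have hcB : ContinuousOn bondingFun {p : CircleWedge | p.1.1 = 1} := by
    refine (hr.comp (continuous_snd.comp continuous_subtype_val)).continuousOn.congr
      fun p hp => ?_
    by_cases h : p.1.2 = 1
    · have hpb : p = base := Subtype.ext (Prod.ext hp h)
      subst hpb
      rw [bondingFun_base]
      simp [onQuarters, base, inl]
    · exact if_neg h
  have := hcA.union_of_isClosed hcB hA hB
  rw [← continuousOn_univ]
  refine this.mono fun p _ => p.2

/-- The self-map `f` of the wedge. -/
def bonding : C(CircleWedge, CircleWedge) := ⟨bondingFun, continuous_bondingFun⟩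

theorem bonding_base : bonding base = base := bondingFun_base

/-- The endomorphism of `π₁(B, (1, 1))` induced by `f`. -/
def bondingHom : FundamentalGroup CircleWedge base →* FundamentalGroup CircleWedge base :=
  FundamentalGroup.mapOfEq bonding bonding_base

/-- The inverse sequence of groups `π₁(B) ← π₁(B) ← π₁(B) ← ⋯` with all bonding homomorphisms
induced by `f`. -/
def proGroup : ℕᵒᵖ ⥤ GrpCat :=
  Functor.ofOpSequence (X := fun _ => GrpCat.of (FundamentalGroup CircleWedge base))
    (fun _ => GrpCat.ofHom bondingHom)

end CircleWedge

end

/-! The group π₁(B) is free on the two standard loops a, b, and f_* is an endomorphism φ that sends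
each generator to a commutator. The images of the letters a, a⁻¹, b, b⁻¹ are reduced words of length
4 with pairwise distinct first letters, so nothing cancels between the blocks of the image of a
reduced word, and φ multiplies word length by exactly 4 (`norm_commutatorEnd`). Hence φ is
injective. Comparing lengths of high powers shows moreover that φ^m(a) is never conjugate to any
φ^(m+1)(h) (`commutatorEnd_iterate_of_ne_conj`). With trivial conjugator this says that the images
of the iterates decrease strictly, which excludes surjectivity and the Mittag-Leffler condition.

Movability of the limit would give, for some m, a map g : B → B with f^m freely homotopic to f^(m+1)
∘ g (`exists_homotopic_iterate_of_isMovable`). A free homotopy determines the effect on π₁ only up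
to conjugation along the track of the base point, so φ^m(a) would be conjugate to some φ^(m+1)(h).
This is why the algebra has to exclude conjugates, and not only equality.

Freeness of π₁(B) has two halves. Every loop is homotopic to one that breaks into paths inside
single circles, so a and b generate (`freeHom_surjective`). A covering with fibre the free group, on
which a word acts by left translation, shows that there are no relations (`freeHom_injective`). -/

noncomputable section

/-! ### The commutator endomorphism of the free group of rank two. -/

namespace FreeGroup

/-- The endomorphism of the free group on `a, b` with `a ↦ b⁻¹a⁻¹ba` and `b ↦ bab⁻¹a⁻¹`. -/
def commutatorEnd : FreeGroup (Fin 2) →* FreeGroup (Fin 2) :=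
  lift ![(of 1)⁻¹ * (of 0)⁻¹ * (of 1 * of 0), of 1 * of 0 * ((of 1)⁻¹ * (of 0)⁻¹)]

/-- The reduced word of the image of a letter under `commutatorEnd`. -/
def commutatorBlock : Fin 2 × Bool → List (Fin 2 × Bool)
  | (0, true) => [(1, false), (0, false), (1, true), (0, true)]
  | (0, false) => [(0, false), (1, false), (0, true), (1, true)]
  | (1, true) => [(1, true), (0, true), (1, false), (0, false)]
  | (1, false) => [(0, true), (1, true), (0, false), (1, false)]

theorem mk_commutatorBlock (x : Fin 2 × Bool) :
    mk (commutatorBlock x) = commutatorEnd (mk [x]) := by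
  obtain ⟨i, c⟩ := x
  fin_cases i <;> cases c <;> rfl

theorem commutatorEnd_mk (w : List (Fin 2 × Bool)) :
    commutatorEnd (mk w) = mk (w.flatMap commutatorBlock) := by
  induction w with
  | nil => rfl
  | cons x w ih =>
    rw [List.flatMap_cons, ← mul_mk, ← ih, mk_commutatorBlock, ← commutatorEnd.map_mul, mul_mk]
    rfl

/-- The last letter of the block of x is inverse to the first letter of the block of y only if y =
x⁻¹, and this pair does not occur in a reduced word. There are only finitely many letters to check.
-/
theorem isReduced_flatMap_commutatorBlock {w : List (Fin 2 × Bool)} (h : IsReduced w) :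
    IsReduced (w.flatMap commutatorBlock) := by
  have hne : ∀ x, commutatorBlock x ≠ [] := by decide
  have hred : ∀ x, (commutatorBlock x).IsChain (fun a b => a.1 = b.1 → a.2 = b.2) := by decide
  have hstep : ∀ x y : Fin 2 × Bool, (x.1 = y.1 → x.2 = y.2) →
      ∀ a ∈ (commutatorBlock x).getLast?, ∀ b ∈ (commutatorBlock y).head?,
        a.1 = b.1 → a.2 = b.2 := by decide
  rw [IsReduced, List.flatMap_def, List.isChain_flatten
    fun hmem => (List.mem_map.1 hmem).elim fun x hx => hne x hx.2]
  refine ⟨fun l hl => ?_, ?_⟩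
  · obtain ⟨x, -, rfl⟩ := List.mem_map.1 hl
    exact hred x
  rw [List.isChain_map]
  exact List.IsChain.imp (fun x y => hstep x y) h

theorem norm_commutatorEnd (w : FreeGroup (Fin 2)) : (commutatorEnd w).norm = 4 * w.norm := by
  have hlen : ∀ x, (commutatorBlock x).length = 4 := by decide
  conv_lhs => rw [← mk_toWord (x := w), commutatorEnd_mk]
  rw [norm, toWord_mk, (isReduced_flatMap_commutatorBlock isReduced_toWord).reduce_eq,
    List.length_flatMap]
  simp [hlen, norm, mul_comm]

theorem norm_commutatorEnd_iterate (n : ℕ) (w : FreeGroup (Fin 2)) :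
    (commutatorEnd^[n] w).norm = 4 ^ n * w.norm := by
  induction n with
  | zero => simp
  | succ n ih => rw [Function.iterate_succ_apply', norm_commutatorEnd, ih, pow_succ]; ring

theorem commutatorEnd_injective : Function.Injective commutatorEnd := by
  refine (injective_iff_map_eq_one _).2 fun w hw => norm_eq_zero.1 ?_
  have := norm_commutatorEnd w
  rw [hw, norm_one] at this
  omega

/-- Write w = c u c⁻¹ with u cyclically reduced and nonempty. Then c uⁿ c⁻¹ is already reduced, so
each factor contributes at least one letter. -/
theorem le_norm_pow {α : Type*} [DecidableEq α] {w : FreeGroup α} (hw : w ≠ 1) (n : ℕ) :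
    n ≤ (w ^ n).norm := by
  rcases Nat.eq_zero_or_pos n with rfl | hn
  · simp
  have hc : reduceCyclically w.toWord ≠ [] := by
    intro h
    apply hw
    have := reduceCyclically.conj_conjugator_reduceCyclically w.toWord
    rw [h, List.append_nil] at this
    rw [← mk_toWord (x := w), ← this, ← mul_mk, ← inv_mk, mul_inv_cancel]
  have := List.length_pos_iff.2 hc
  rw [norm, toWord_pow, reduceCyclically.reduce_flatten_replicate isReduced_toWord, if_neg hn.ne']
  simp only [List.length_append, List.length_flatten, List.map_replicate, List.sum_replicate,
    smul_eq_mul]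
  nlinarith

/-- No conjugate of an iterated image of a generator lies in the range of a later iterate. -/
theorem commutatorEnd_iterate_of_ne_conj (m : ℕ) (c h : FreeGroup (Fin 2)) :
    commutatorEnd^[m] (of 0) ≠ c * commutatorEnd^[m + 1] h * c⁻¹ := by
  intro heq
  have hiter : ∀ k n (w : FreeGroup (Fin 2)),
      (commutatorEnd^[k] w) ^ n = commutatorEnd^[k] (w ^ n) := fun k n w =>
    (iterate_map_pow commutatorEnd k w n).symm
  have hh : h ≠ 1 := by
    rintro rfl
    rw [iterate_map_one, mul_one, mul_inv_cancel] at heq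
    have := norm_commutatorEnd_iterate m (of 0)
    rw [heq, norm_one, norm_of] at this
    have := pow_pos (show 0 < 4 by norm_num) m
    omega
  -- In n-th powers the conjugator still costs at most 2|c|, whereas the other lengths grow with n:
  -- 4^(m+1)·n ≤ 2|c| + 4^m·n, which fails once n > 2|c|.
  set n := 2 * c.norm + 1 with hn
  have hinv : commutatorEnd^[m + 1] (h ^ n) = c⁻¹ * commutatorEnd^[m] (of 0 ^ n) * c := by
    rw [← hiter, ← hiter, heq, conj_pow]
    group
  have h1 : (commutatorEnd^[m + 1] (h ^ n)).norm ≤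
      c.norm + (commutatorEnd^[m] (of 0 ^ n)).norm + c.norm := by
    rw [hinv]
    refine (norm_mul_le _ _).trans (Nat.add_le_add_right ((norm_mul_le _ _).trans ?_) _)
    rw [norm_inv_eq]
  have h2 := le_norm_pow hh n
  rw [norm_commutatorEnd_iterate, norm_commutatorEnd_iterate, norm_of_pow, pow_succ] at h1
  have h3 := Nat.one_le_pow m 4 (by norm_num)
  nlinarith [Nat.mul_le_mul_left (4 ^ m) h2]

end FreeGroup
end

/-! ### Generation of the fundamental group of the circle. -/

noncomputable section

namespace Circle

/-- The loop that runs once around the circle. -/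
def stdLoop : Path (1 : Circle) 1 where
  toFun t := exp (2 * Real.pi * t)
  source' := by simp
  target' := by simp

theorem stdLoop_apply (t : unitInterval) : stdLoop t = exp (2 * Real.pi * t) := rfl

/-- The segment from `0` to `2π`, which lifts the standard loop. -/
def stdLoopLift : Path (0 : ℝ) (2 * Real.pi) where
  toFun t := 2 * Real.pi * t
  source' := by simp
  target' := by simp

/-- The covering `exp` embeds the group in its deck group 2πℤ, and the standard loop goes to the
generator 2π. -/
theorem mem_zpowers_stdLoop (γ : FundamentalGroup Circle 1) :
    γ ∈ Subgroup.zpowers (FundamentalGroup.fromPath (.mk stdLoop)) := by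
  let hp := isAddQuotientCoveringMap_exp
  let e : exp ⁻¹' {1} := ⟨0, by simp⟩
  let e' : exp ⁻¹' {1} := ⟨2 * Real.pi, by simp⟩
  have hmono : hp.isCoveringMap.monodromy (.mk stdLoop) e = e' :=
    hp.isCoveringMap.monodromy_eq_of_map_eq (ex := e) (ey := e') (.mk stdLoopLift) rfl
  have hstd : hp.fundamentalGroupToMulOpposite e (FundamentalGroup.fromPath (.mk stdLoop)) =
      MulOpposite.op (Multiplicative.ofAdd
        (⟨2 * Real.pi, AddSubgroup.mem_zmultiples _⟩ : AddSubgroup.zmultiples (2 * Real.pi))) := by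
    rw [hp.fundamentalGroupToMulOpposite_apply_eq_Iff]
    refine Eq.trans ?_ (congrArg Subtype.val hmono.symm)
    change (2 * Real.pi) + 0 = 2 * Real.pi
    simp
  obtain ⟨n, hn⟩ := AddSubgroup.mem_zmultiples_iff.1
    (hp.fundamentalGroupToMulOpposite e γ).unop.toAdd.2
  refine ⟨n, hp.fundamentalGroupToMulOpposite_injective e ?_⟩
  change hp.fundamentalGroupToMulOpposite e (_ ^ n) = _
  rw [map_zpow, hstd]
  apply MulOpposite.unop_injective
  apply Multiplicative.toAdd.injective
  apply Subtype.ext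
  simpa using hn

end Circle

/-! ### Loops composed of paths in single circles are words in a and b. -/

namespace CircleWedge

/-- The inclusion of the first circle. -/
def inlMap : C(Circle, CircleWedge) := ⟨inl, continuous_inl⟩

/-- The inclusion of the second circle. -/
def inrMap : C(Circle, CircleWedge) := ⟨inr, continuous_inr⟩

/-- The standard loop of the first circle. -/
def loopInl : Path base base := (Circle.stdLoop.map continuous_inl).cast rfl rfl

/-- The standard loop of the second circle. -/
def loopInr : Path base base := (Circle.stdLoop.map continuous_inr).cast rfl rfl

/-- The homomorphism from the free group that sends the generators to the standard loops. -/
def freeHom : FreeGroup (Fin 2) →* FundamentalGroup CircleWedge base :=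
  FreeGroup.lift ![FundamentalGroup.fromPath (.mk loopInl), FundamentalGroup.fromPath (.mk loopInr)]

theorem freeHom_of_zero :
    freeHom (FreeGroup.of 0) = FundamentalGroup.fromPath (.mk loopInl) := by
  simp [freeHom]

theorem freeHom_of_one :
    freeHom (FreeGroup.of 1) = FundamentalGroup.fromPath (.mk loopInr) := by
  simp [freeHom]

theorem map_inlMap_mem_range (p : FundamentalGroup Circle 1) :
    (Path.Homotopic.Quotient.map p inlMap : FundamentalGroup CircleWedge base) ∈
      freeHom.range := by
  obtain ⟨n, rfl⟩ := Circle.mem_zpowers_stdLoop p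
  exact ⟨FreeGroup.of 0 ^ n, (map_zpow freeHom _ n).trans
    ((congrArg (· ^ n) freeHom_of_zero).trans
      (map_zpow (FundamentalGroup.map inlMap 1) (.mk Circle.stdLoop) n).symm)⟩

theorem map_inrMap_mem_range (p : FundamentalGroup Circle 1) :
    (Path.Homotopic.Quotient.map p inrMap : FundamentalGroup CircleWedge base) ∈
      freeHom.range := by
  obtain ⟨n, rfl⟩ := Circle.mem_zpowers_stdLoop p
  exact ⟨FreeGroup.of 1 ^ n, (map_zpow freeHom _ n).trans
    ((congrArg (· ^ n) freeHom_of_one).trans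
      (map_zpow (FundamentalGroup.map inrMap 1) (.mk Circle.stdLoop) n).symm)⟩

/-- The path classes that are products of classes of paths in one of the two circles. -/
inductive IsCirclewise : ∀ x : CircleWedge, Path.Homotopic.Quotient base x → Prop
  | refl : IsCirclewise base (.refl base)
  | inl {z w : Circle} (c : Path.Homotopic.Quotient base (inl z))
      (p : Path.Homotopic.Quotient z w) :
      IsCirclewise (inl z) c → IsCirclewise (inl w) (c.trans (p.map inlMap))
  | inr {z w : Circle} (c : Path.Homotopic.Quotient base (inr z))
      (p : Path.Homotopic.Quotient z w) :
      IsCirclewise (inr z) c → IsCirclewise (inr w) (c.trans (p.map inrMap))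

theorem inl_injective : Function.Injective inl := fun _ _ h =>
  congrArg (fun x : CircleWedge => x.1.1) h

theorem inr_injective : Function.Injective inr := fun _ _ h =>
  congrArg (fun x : CircleWedge => x.1.2) h

theorem eq_one_of_inl_eq_inr {z w : Circle} (h : inl z = inr w) : z = 1 ∧ w = 1 :=
  ⟨congrArg (fun x : CircleWedge => x.1.1) h, (congrArg (fun x : CircleWedge => x.1.2) h).symm⟩

theorem map_trans {X Y : Type*} [TopologicalSpace X] [TopologicalSpace Y] (f : C(X, Y))
    {x y z : X} (p : Path.Homotopic.Quotient x y) (q : Path.Homotopic.Quotient y z) :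
    (p.trans q).map f = (p.map f).trans (q.map f) :=
  (FundamentalGroupoid.map f).map_comp (X := ⟨x⟩) (Y := ⟨y⟩) (Z := ⟨z⟩) p q

theorem mem_range_congr {γ γ' : FundamentalGroup CircleWedge base} (h : γ = γ')
    (h' : γ' ∈ freeHom.range) : γ ∈ freeHom.range :=
  h ▸ h'

/-- For the induction, a class ending at x is closed up by a path inside a circle through x. If the
last piece lies in the same circle, it is absorbed into the closing path. If it lies in the other
circle, then x is the base point and the product splits into two loops. The heterogeneous equality
allows the endpoint x to be an index of the induction. -/
theorem IsCirclewise.mem_range_aux {x : CircleWedge} {c : Path.Homotopic.Quotient base x}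
    (h : IsCirclewise x c) :
    (∀ (z : Circle) (_ : x = CircleWedge.inl z) (p : Path.Homotopic.Quotient z 1)
      (d : Path.Homotopic.Quotient x base), d ≍ p.map inlMap →
      (c.trans d : FundamentalGroup CircleWedge base) ∈ freeHom.range) ∧
    (∀ (z : Circle) (_ : x = CircleWedge.inr z) (p : Path.Homotopic.Quotient z 1)
      (d : Path.Homotopic.Quotient x base), d ≍ p.map inrMap →
      (c.trans d : FundamentalGroup CircleWedge base) ∈ freeHom.range) := by
  induction h with
  | refl =>
    refine ⟨fun z hz p d hd => ?_, fun z hz p d hd => ?_⟩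
    · obtain rfl : 1 = z := inl_injective hz
      obtain rfl := eq_of_heq hd
      exact mem_range_congr
        (Path.Homotopic.Quotient.refl_trans _) (map_inlMap_mem_range p)
    · obtain rfl : 1 = z := inr_injective hz
      obtain rfl := eq_of_heq hd
      exact mem_range_congr
        (Path.Homotopic.Quotient.refl_trans _) (map_inrMap_mem_range p)
  | @inl z w c p _ ih =>
    refine ⟨fun u hu q d hd => ?_, fun u hu q d hd => ?_⟩
    · obtain rfl := inl_injective hu
      obtain rfl := eq_of_heq hd
      exact mem_range_congr
        (Path.Homotopic.Quotient.trans_assoc _ _ _)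
        (ih.1 z rfl (p.trans q) _ (heq_of_eq (map_trans inlMap p q).symm))
    · obtain ⟨rfl, rfl⟩ := eq_one_of_inl_eq_inr hu
      obtain rfl := eq_of_heq hd
      exact mul_mem (map_inrMap_mem_range q) (ih.1 z rfl p _ HEq.rfl)
  | @inr z w c p _ ih =>
    refine ⟨fun u hu q d hd => ?_, fun u hu q d hd => ?_⟩
    · obtain ⟨rfl, rfl⟩ := eq_one_of_inl_eq_inr hu.symm
      obtain rfl := eq_of_heq hd
      exact mul_mem (map_inlMap_mem_range q) (ih.2 z rfl p _ HEq.rfl)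
    · obtain rfl := inr_injective hu
      obtain rfl := eq_of_heq hd
      exact mem_range_congr
        (Path.Homotopic.Quotient.trans_assoc _ _ _)
        (ih.2 z rfl (p.trans q) _ (heq_of_eq (map_trans inrMap p q).symm))

theorem IsCirclewise.mem_range {c : Path.Homotopic.Quotient base base}
    (h : IsCirclewise base c) : (c : FundamentalGroup CircleWedge base) ∈ freeHom.range := by
  have := h.mem_range_aux.1 1 rfl (.refl 1) (.refl base) HEq.rfl
  rwa [Path.Homotopic.Quotient.trans_refl] at this

end CircleWedge
end

/-! ### Every loop in the wedge is homotopic to a circlewise one. -/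

noncomputable section

open scoped unitInterval

namespace Complex

open Classical in
/-- Radial projection to the unit circle, with value `1` at `0`. -/
def toCircle (z : ℂ) : Circle :=
  if h : z = 0 then 1 else ⟨z / ‖z‖, mem_sphere_zero_iff_norm.2 (by simp [h])⟩

theorem coe_toCircle {z : ℂ} (h : z ≠ 0) : (toCircle z : ℂ) = z / ‖z‖ := by
  exact congrArg (fun w : Circle => (w : ℂ)) (dif_neg h)

theorem toCircle_coe (z : Circle) : toCircle z = z := by
  refine Circle.ext ((coe_toCircle z.coe_ne_zero).trans ?_)
  rw [Circle.norm_coe, ofReal_one, div_one]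

theorem toCircle_ofReal {x : ℝ} (h : 0 < x) : toCircle x = 1 := by
  apply Circle.ext
  rw [coe_toCircle (by exact_mod_cast h.ne')]
  have : (x : ℂ) ≠ 0 := by exact_mod_cast h.ne'
  simp [abs_of_pos h, this]

theorem continuous_toCircle_comp {X : Type*} [TopologicalSpace X] {g : X → ℂ} (hg : Continuous g)
    (h : ∀ x, g x ≠ 0) : Continuous fun x => toCircle (g x) := by
  refine Topology.IsInducing.subtypeVal.continuous_iff.2 ?_
  have : Continuous fun x => g x / ((‖g x‖ : ℝ) : ℂ) :=
    hg.div (by fun_prop) fun x => by simpa using h x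
  exact this.congr fun x => (coe_toCircle (h x)).symm

/-- Move the imaginary part towards `0` by at most `d`. -/
def shrinkIm (d : ℝ) (z : ℂ) : ℂ := ⟨z.re, z.im - max (-d) (min d z.im)⟩

theorem continuous_shrinkIm : Continuous fun p : ℝ × ℂ => shrinkIm p.1 p.2 := by
  have h : (fun p : ℝ × ℂ => shrinkIm p.1 p.2) = fun p : ℝ × ℂ =>
      ((p.2.re : ℝ) : ℂ) + ((p.2.im - max (-p.1) (min p.1 p.2.im) : ℝ) : ℂ) * Complex.I := by
    funext p
    apply Complex.ext <;> simp [shrinkIm]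
  rw [h]
  fun_prop

theorem shrinkIm_zero (z : ℂ) : shrinkIm 0 z = z := by
  apply Complex.ext <;> simp [shrinkIm]

theorem shrinkIm_of_abs_le {d : ℝ} {z : ℂ} (h : |z.im| ≤ d) : shrinkIm d z = z.re := by
  obtain ⟨h1, h2⟩ := abs_le.1 h
  apply Complex.ext <;> simp [shrinkIm, min_eq_right h2, max_eq_right h1]

theorem toCircle_shrinkIm {d : ℝ} {z : ℂ} (h : |z.im| ≤ d) (hz : 0 < z.re) :
    toCircle (shrinkIm d z) = 1 := by
  rw [shrinkIm_of_abs_le h, toCircle_ofReal hz]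

theorem toCircle_shrinkIm_one {d : ℝ} (hd : 0 ≤ d) : toCircle (shrinkIm d (1 : Circle)) = 1 :=
  toCircle_shrinkIm (by simpa using hd) (by simp)

theorem shrinkIm_ne_zero {d : ℝ} (hd' : 0 ≤ d) (hd : d < 1) (z : Circle) : shrinkIm d z ≠ 0 := by
  intro h
  have hre : (z : ℂ).re = 0 := congrArg re h
  have him : (z : ℂ).im - max (-d) (min d (z : ℂ).im) = 0 := congrArg im h
  have hn : (z : ℂ).re * (z : ℂ).re + (z : ℂ).im * (z : ℂ).im = 1 := by
    rw [← normSq_apply]; exact Circle.normSq_coe z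
  rw [hre] at hn
  rcases max_cases (-d) (min d (z : ℂ).im) with ⟨h1, h2⟩ | ⟨h1, h2⟩ <;>
  rcases min_cases d (z : ℂ).im with ⟨h3, h4⟩ | ⟨h3, h4⟩ <;> nlinarith

end Complex

namespace CircleWedge
open Complex

/-- The deformation of the wedge that shrinks the ends of each of the two circles to the base
point. -/
def shrinkFun (p : I × CircleWedge) : CircleWedge :=
  ⟨(toCircle (shrinkIm (p.1 / 2) p.2.1.1), toCircle (shrinkIm (p.1 / 2) p.2.1.2)), by
    have h := p.1.2.1
    refine p.2.2.imp (fun hp => ?_) fun hp => ?_ <;> dsimp only <;> rw [hp] <;>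
    exact toCircle_shrinkIm_one (by linarith)⟩

theorem continuous_shrinkFun : Continuous shrinkFun := by
  -- Shrinking by less than 1 keeps the points ±i, and hence the whole circle, away from 0, where
  -- the radial projection is discontinuous.
  have hlt : ∀ t : I, (t : ℝ) / 2 < 1 := fun t => by linarith [t.2.2]
  refine Continuous.subtype_mk (Continuous.prodMk ?_ ?_) _
  · refine continuous_toCircle_comp (continuous_shrinkIm.comp (by fun_prop :
      Continuous fun p : I × CircleWedge => ((p.1 : ℝ) / 2, (p.2.1.1 : ℂ)))) fun p => ?_
    exact shrinkIm_ne_zero (by linarith [p.1.2.1]) (hlt _) _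
  · refine continuous_toCircle_comp (continuous_shrinkIm.comp (by fun_prop :
      Continuous fun p : I × CircleWedge => ((p.1 : ℝ) / 2, (p.2.1.2 : ℂ)))) fun p => ?_
    exact shrinkIm_ne_zero (by linarith [p.1.2.1]) (hlt _) _

theorem shrinkFun_zero (x : CircleWedge) : shrinkFun (0, x) = x := by
  apply Subtype.ext
  simp [shrinkFun, shrinkIm_zero, toCircle_coe]

theorem shrinkFun_base (t : I) : shrinkFun (t, base) = base := by
  have h := t.2.1
  apply Subtype.ext
  simp only [shrinkFun, base]
  rw [toCircle_shrinkIm_one (by linarith)]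

/-- The loop obtained by shrinking the ends of both circles to the base point. -/
def shrinkLoop (γ : Path base base) : Path base base where
  toFun t := shrinkFun (1, γ t)
  continuous_toFun := continuous_shrinkFun.comp (by fun_prop)
  source' := by rw [γ.source, shrinkFun_base]
  target' := by rw [γ.target, shrinkFun_base]

theorem shrinkLoop_homotopic (γ : Path base base) : γ.Homotopic (shrinkLoop γ) := by
  refine ⟨⟨⟨⟨fun p => shrinkFun (p.1, γ p.2), continuous_shrinkFun.comp (by fun_prop)⟩,
    fun t => shrinkFun_zero _, fun t => rfl⟩, ?_⟩⟩
  rintro t x (rfl | rfl)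
  · simpa using shrinkFun_base t
  · simpa using shrinkFun_base t

theorem IsCirclewise.trans_left {x y : CircleWedge} {c : Path.Homotopic.Quotient base x}
    (h : IsCirclewise x c) (δ : Path x y) (hδ : ∀ t, (δ t).1.2 = 1) :
    IsCirclewise y (c.trans (.mk δ)) := by
  obtain ⟨z, rfl⟩ : ∃ z, x = CircleWedge.inl z :=
    ⟨x.1.1, Subtype.ext (Prod.ext rfl ((congrArg (fun q : CircleWedge => q.1.2) δ.source).symm.trans (hδ 0)))⟩
  obtain ⟨w, rfl⟩ : ∃ w, y = CircleWedge.inl w :=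
    ⟨y.1.1, Subtype.ext (Prod.ext rfl ((congrArg (fun q : CircleWedge => q.1.2) δ.target).symm.trans (hδ 1)))⟩
  let p : Path z w :=
    { toFun := fun t => (δ t).1.1
      source' := by rw [δ.source]; rfl
      target' := by rw [δ.target]; rfl }
  have hp : δ = p.map continuous_inl :=
    Path.ext (funext fun t => Subtype.ext (Prod.ext rfl (hδ t)))
  rw [hp]
  exact h.inl c (.mk p)

theorem IsCirclewise.trans_right {x y : CircleWedge} {c : Path.Homotopic.Quotient base x}
    (h : IsCirclewise x c) (δ : Path x y) (hδ : ∀ t, (δ t).1.1 = 1) :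
    IsCirclewise y (c.trans (.mk δ)) := by
  obtain ⟨z, rfl⟩ : ∃ z, x = CircleWedge.inr z :=
    ⟨x.1.2, Subtype.ext (Prod.ext ((congrArg (fun q : CircleWedge => q.1.1) δ.source).symm.trans (hδ 0)) rfl)⟩
  obtain ⟨w, rfl⟩ : ∃ w, y = CircleWedge.inr w :=
    ⟨y.1.2, Subtype.ext (Prod.ext ((congrArg (fun q : CircleWedge => q.1.1) δ.target).symm.trans (hδ 1)) rfl)⟩
  let p : Path z w :=
    { toFun := fun t => (δ t).1.2
      source' := by rw [δ.source]; rfl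
      target' := by rw [δ.target]; rfl }
  have hp : δ = p.map continuous_inr :=
    Path.ext (funext fun t => Subtype.ext (Prod.ext (hδ t) rfl))
  rw [hp]
  exact h.inr c (.mk p)

/-- Each point of the wedge has a neighbourhood that is shrunk into one of the circles. -/
theorem shrinkFun_one_mem (x : CircleWedge) :
    (∀ᶠ y in nhds x, (shrinkFun (1, y)).1.2 = 1) ∨
      ∀ᶠ y in nhds x, (shrinkFun (1, y)).1.1 = 1 := by
  refine x.2.imp (fun hx => ?_) fun hx => ?_
  · have h1 : ∀ᶠ y : CircleWedge in nhds x, |(y.1.2 : ℂ).im| < 1 / 2 :=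
      ContinuousAt.eventually_lt (by fun_prop) continuousAt_const (by simp [hx])
    have h2 : ∀ᶠ y : CircleWedge in nhds x, 0 < (y.1.2 : ℂ).re :=
      ContinuousAt.eventually_lt continuousAt_const (by fun_prop) (by simp [hx])
    filter_upwards [h1, h2] with y hy hy'
    exact toCircle_shrinkIm (by simpa using hy.le) hy'
  · have h1 : ∀ᶠ y : CircleWedge in nhds x, |(y.1.1 : ℂ).im| < 1 / 2 :=
      ContinuousAt.eventually_lt (by fun_prop) continuousAt_const (by simp [hx])
    have h2 : ∀ᶠ y : CircleWedge in nhds x, 0 < (y.1.1 : ℂ).re :=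
      ContinuousAt.eventually_lt continuousAt_const (by fun_prop) (by simp [hx])
    filter_upwards [h1, h2] with y hy hy'
    exact toCircle_shrinkIm (by simpa using hy.le) hy'

theorem eventually_uIcc {P : I → Prop} {s : I} (h : ∀ᶠ u in nhds s, P u) :
    ∀ᶠ t in nhds s, ∀ u ∈ Set.uIcc s t, P u := by
  obtain ⟨ε, hε, hP⟩ := Metric.eventually_nhds_iff.1 h
  refine Metric.eventually_nhds_iff.2 ⟨ε, hε, fun t ht u hu => hP (lt_of_le_of_lt ?_ ht)⟩
  have hu' : (u : ℝ) ∈ Set.uIcc (s : ℝ) t := by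
    rcases Set.mem_uIcc.1 hu with h | h
    · exact Set.mem_uIcc.2 (Or.inl ⟨h.1, h.2⟩)
    · exact Set.mem_uIcc.2 (Or.inr ⟨h.1, h.2⟩)
  rw [Subtype.dist_eq, Subtype.dist_eq, Real.dist_eq, Real.dist_eq]
  exact Set.abs_sub_left_of_mem_uIcc hu'

/-- A loop may change circles infinitely often near the base point. After the shrinking, each
parameter has a neighbourhood that is mapped into a single circle, and connectedness of the interval
replaces a subdivision. -/
theorem isCirclewise_shrinkLoop (γ : Path base base) :
    IsCirclewise base (.mk (shrinkLoop γ)) := by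
  set δ := shrinkLoop γ with hδ
  let c : ∀ s : I, Path.Homotopic.Quotient base (δ s) := fun s =>
    .mk ((δ.subpath 0 s).cast δ.source.symm rfl)
  have hc : ∀ s t, c t = (c s).trans (.mk (δ.subpath s t)) := by
    intro s t
    rw [← Path.Homotopic.Quotient.mk_trans]
    refine Path.Homotopic.Quotient.eq.2 ?_
    have := (Path.Homotopic.pathCast ⟨Path.Homotopy.subpathTransSubpath δ 0 s t⟩
      δ.source.symm rfl).symm
    exact this
  -- The implication is a transitive relation in s and t that holds in both directions for nearby
  -- parameters, hence for all pairs.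
  have key : ∀ s t, IsCirclewise (δ s) (c s) → IsCirclewise (δ t) (c t) := by
    refine fun s t => PreconnectedSpace.induction₂'
      (fun s t => IsCirclewise (δ s) (c s) → IsCirclewise (δ t) (c t)) (fun s => ?_)
      ⟨fun _ _ _ h1 h2 => h2 ∘ h1⟩ s t
    rcases shrinkFun_one_mem (γ s) with h | h
    · filter_upwards [eventually_uIcc (γ.continuous.continuousAt.eventually h)] with t ht
      have hr : ∀ u v, Set.uIcc u v = Set.uIcc s t → ∀ r, (δ.subpath u v r).1.2 = 1 := by
        intro u v huv r
        have : δ.subpath u v r ∈ δ '' Set.uIcc u v := by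
          rw [← Path.range_subpath]; exact ⟨r, rfl⟩
        obtain ⟨q, hq, hq'⟩ := this
        rw [← hq']
        exact ht q (huv ▸ hq)
      exact ⟨fun hs => hc s t ▸ hs.trans_left _ (hr s t rfl),
        fun hs => hc t s ▸ hs.trans_left _ (hr t s (Set.uIcc_comm _ _))⟩
    · filter_upwards [eventually_uIcc (γ.continuous.continuousAt.eventually h)] with t ht
      have hr : ∀ u v, Set.uIcc u v = Set.uIcc s t → ∀ r, (δ.subpath u v r).1.1 = 1 := by
        intro u v huv r
        have : δ.subpath u v r ∈ δ '' Set.uIcc u v := by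
          rw [← Path.range_subpath]; exact ⟨r, rfl⟩
        obtain ⟨q, hq, hq'⟩ := this
        rw [← hq']
        exact ht q (huv ▸ hq)
      exact ⟨fun hs => hc s t ▸ hs.trans_right _ (hr s t rfl),
        fun hs => hc t s ▸ hs.trans_right _ (hr t s (Set.uIcc_comm _ _))⟩
  have aux : ∀ {x : CircleWedge} (hx : base = x) (d : Path.Homotopic.Quotient base x),
      IsCirclewise x d ↔ IsCirclewise base (d.cast rfl hx) := by
    rintro _ rfl d
    rw [Path.Homotopic.Quotient.cast_rfl_rfl]
  have h0 : IsCirclewise (δ 0) (c 0) := by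
    rw [aux δ.source.symm]
    convert IsCirclewise.refl
    rw [← Path.Homotopic.Quotient.mk_cast, ← Path.Homotopic.Quotient.mk_refl]
    congr 1
    ext r <;> simp
  have h1 := key 0 1 h0
  rw [aux δ.target.symm] at h1
  convert h1
  rw [← Path.Homotopic.Quotient.mk_cast]
  congr 1
  ext r <;> simp

theorem freeHom_surjective : Function.Surjective freeHom := by
  intro γ
  obtain ⟨γ, rfl⟩ := Path.Homotopic.Quotient.mk_surjective γ
  have := (isCirclewise_shrinkLoop γ).mem_range
  rwa [← Path.Homotopic.Quotient.eq.2 (shrinkLoop_homotopic γ)] at this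

end CircleWedge
end

/-! ### The covering with free fibre, and independence of the two loops. -/

noncomputable section

open scoped unitInterval

namespace CircleWedge

theorem stdLoop_re (t : I) : (Circle.stdLoop t : ℂ).re = Real.cos (2 * Real.pi * t) := by
  rw [Circle.stdLoop_apply, Circle.coe_exp]
  exact_mod_cast Complex.exp_ofReal_mul_I_re _

theorem stdLoop_im (t : I) : (Circle.stdLoop t : ℂ).im = Real.sin (2 * Real.pi * t) := by
  rw [Circle.stdLoop_apply, Circle.coe_exp]
  exact_mod_cast Complex.exp_ofReal_mul_I_im _

theorem stdLoop_im_pos {t : I} (h : 0 < (t : ℝ)) (h' : (t : ℝ) < 1 / 2) :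
    0 < (Circle.stdLoop t : ℂ).im := by
  rw [stdLoop_im]
  apply Real.sin_pos_of_pos_of_lt_pi <;> nlinarith [Real.pi_pos]

theorem stdLoop_im_neg {t : I} (h : 1 / 2 < (t : ℝ)) (h' : (t : ℝ) < 1) :
    (Circle.stdLoop t : ℂ).im < 0 := by
  rw [stdLoop_im, ← Real.sin_sub_two_pi]
  apply Real.sin_neg_of_neg_of_neg_pi_lt <;> nlinarith [Real.pi_pos]

theorem stdLoop_half {t : I} (h : (t : ℝ) = 1 / 2) : Circle.stdLoop t = -1 := by
  have : 2 * Real.pi * (t : ℝ) = Real.pi := by rw [h]; ring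
  apply Circle.ext
  apply Complex.ext
  · rw [stdLoop_re, this]; simp
  · rw [stdLoop_im, this]; simp

theorem stdLoop_ne_neg_one {t : I} (h : (t : ℝ) ≠ 1 / 2) : Circle.stdLoop t ≠ -1 := by
  intro heq
  have him : (Circle.stdLoop t : ℂ).im = 0 := by rw [heq]; simp
  have hre : (Circle.stdLoop t : ℂ).re = -1 := by rw [heq]; simp
  rcases eq_or_lt_of_le t.2.1 with h0 | h0
  · rw [stdLoop_re, ← h0] at hre; norm_num at hre
  rcases eq_or_lt_of_le t.2.2 with h1 | h1
  · rw [stdLoop_re, h1] at hre; norm_num at hre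
  rcases lt_or_gt_of_ne h with h | h
  · exact (stdLoop_im_pos h0 h).ne' him
  · exact (stdLoop_im_neg h h1).ne him

theorem stdLoop_ne_one {t : I} (h : 0 < (t : ℝ)) (h' : (t : ℝ) < 1) : Circle.stdLoop t ≠ 1 := by
  intro heq
  have him : (Circle.stdLoop t : ℂ).im = 0 := by rw [heq]; simp
  have hre : (Circle.stdLoop t : ℂ).re = 1 := by rw [heq]; simp
  rcases lt_trichotomy (t : ℝ) (1 / 2) with h2 | h2 | h2
  · exact (stdLoop_im_pos h h2).ne' him
  · rw [stdLoop_half h2] at hre; norm_num at hre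
  · exact (stdLoop_im_neg h2 h').ne him

theorem one_ne_neg_one : (1 : Circle) ≠ -1 := by
  simpa using stdLoop_ne_neg_one (t := 0) (by norm_num)

/-- Discreteness of the fibre makes the bundle below a covering. -/
instance : TopologicalSpace (FreeGroup (Fin 2)) := ⊥

instance : DiscreteTopology (FreeGroup (Fin 2)) := ⟨rfl⟩

/-- The transition function of the universal covering: a generator on the lower half of each
circle, and `1` elsewhere. -/
def transition (x : CircleWedge) : FreeGroup (Fin 2) :=
  if (x.1.1 : ℂ).im < 0 then .of 0 else if (x.1.2 : ℂ).im < 0 then .of 1 else 1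

/-- The complement of the two points opposite to the base point, and the complement of the base
point. -/
def chart : Bool → Set CircleWedge
  | false => {x | x.1.1 ≠ -1 ∧ x.1.2 ≠ -1}
  | true => {x | x.1.1 ≠ 1 ∨ x.1.2 ≠ 1}

theorem isOpen_chart (i : Bool) : IsOpen (chart i) := by
  cases i
  · exact (isOpen_ne_fun (by fun_prop) continuous_const).inter
      (isOpen_ne_fun (by fun_prop) continuous_const)
  · exact (isOpen_ne_fun (by fun_prop) continuous_const).union
      (isOpen_ne_fun (by fun_prop) continuous_const)

theorem _root_.Circle.eq_one_or_neg_one {z : Circle} (h : (z : ℂ).im = 0) : z = 1 ∨ z = -1 := by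
  have hn : (z : ℂ).re * (z : ℂ).re + (z : ℂ).im * (z : ℂ).im = 1 := by
    rw [← Complex.normSq_apply]; exact Circle.normSq_coe z
  rw [h] at hn
  rcases mul_self_eq_one_iff.1 (by linarith : (z : ℂ).re * (z : ℂ).re = 1) with h' | h'
  · exact Or.inl (Circle.ext (Complex.ext (by simpa using h') (by simpa using h)))
  · exact Or.inr (Circle.ext (Complex.ext (by simpa using h') (by simpa using h)))

/-- A point of both charts lies on an open upper or lower half of one circle, and `transition` is
constant on each of these four open arcs. -/
theorem eventually_transition_eq {x : CircleWedge} (h0 : x ∈ chart false) (h1 : x ∈ chart true) :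
    ∀ᶠ y in nhds x, transition y = transition x := by
  have hne : (x.1.1 : ℂ).im ≠ 0 ∨ (x.1.2 : ℂ).im ≠ 0 := by
    by_contra! h
    have hz := (Circle.eq_one_or_neg_one h.1).resolve_right h0.1
    have hw := (Circle.eq_one_or_neg_one h.2).resolve_right h0.2
    exact h1.elim (· hz) (· hw)
  have hother : ∀ y : CircleWedge, ((y.1.1 : ℂ).im ≠ 0 → (y.1.2 : ℂ).im = 0) := by
    intro y hy
    rcases y.2 with h | h
    · simp [h]
    · simp [h] at hy
  rcases hne with h | h
  · rcases lt_or_gt_of_ne h with h | h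
    · have : ∀ᶠ y : CircleWedge in nhds x, (y.1.1 : ℂ).im < 0 :=
        ContinuousAt.eventually_lt (by fun_prop) continuousAt_const h
      filter_upwards [this] with y hy
      simp [transition, h, hy]
    · have : ∀ᶠ y : CircleWedge in nhds x, 0 < (y.1.1 : ℂ).im :=
        ContinuousAt.eventually_lt continuousAt_const (by fun_prop) h
      filter_upwards [this] with y hy
      simp [transition, h.not_gt, hy.not_gt, hother y hy.ne', hother x h.ne']
  · rcases lt_or_gt_of_ne h with h | h
    · have : ∀ᶠ y : CircleWedge in nhds x, (y.1.2 : ℂ).im < 0 :=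
        ContinuousAt.eventually_lt (by fun_prop) continuousAt_const h
      filter_upwards [this] with y hy
      have h1 : (y.1.1 : ℂ).im = 0 := by_contra fun h' => hy.ne (hother y h')
      have h2 : (x.1.1 : ℂ).im = 0 := by_contra fun h' => h.ne (hother x h')
      simp [transition, h1, h2, h, hy]
    · have : ∀ᶠ y : CircleWedge in nhds x, 0 < (y.1.2 : ℂ).im :=
        ContinuousAt.eventually_lt continuousAt_const (by fun_prop) h
      filter_upwards [this] with y hy
      have h1 : (y.1.1 : ℂ).im = 0 := by_contra fun h' => hy.ne' (hother y h')
      have h2 : (x.1.1 : ℂ).im = 0 := by_contra fun h' => h.ne' (hother x h')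
      simp [transition, h1, h2, h.not_gt, hy.not_gt]

/-- The transition function as a coboundary over the two charts. -/
def chartShift : Bool → CircleWedge → FreeGroup (Fin 2)
  | false, _ => 1
  | true, x => transition x

theorem eventually_chartShift_eq {i j : Bool} {x : CircleWedge} (hi : x ∈ chart i)
    (hj : x ∈ chart j) :
    ∀ᶠ y in nhds x,
      (chartShift j y)⁻¹ * chartShift i y = (chartShift j x)⁻¹ * chartShift i x := by
  cases i <;> cases j
  · exact Filter.Eventually.of_forall fun y => rfl
  · filter_upwards [eventually_transition_eq hi hj] with y hy
    simp [chartShift, hy]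
  · filter_upwards [eventually_transition_eq hj hi] with y hy
    simp [chartShift, hy]
  · simp

open Classical in
/-- The covering of the wedge with fibre the free group of rank two. -/
def coveringCore : FiberBundleCore Bool CircleWedge (FreeGroup (Fin 2)) where
  baseSet := chart
  isOpen_baseSet := isOpen_chart
  indexAt x := if x ∈ chart false then false else true
  mem_baseSet_at x := by
    by_cases h : x ∈ chart false
    · rwa [if_pos h]
    · rw [if_neg h]
      by_contra h'
      simp only [chart, Set.mem_ofPred_eq, not_or, not_not] at h'
      apply h
      exact ⟨h'.1.trans_ne one_ne_neg_one, h'.2.trans_ne one_ne_neg_one⟩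
  coordChange i j x v := (chartShift j x)⁻¹ * chartShift i x * v
  coordChange_self i x _ v := by simp
  continuousOn_coordChange i j := by
    rintro ⟨x, v⟩ ⟨⟨hi, hj⟩, -⟩
    refine ContinuousAt.continuousWithinAt ?_
    have h1 : ∀ᶠ p : CircleWedge × FreeGroup (Fin 2) in nhds (x, v),
        (chartShift j p.1)⁻¹ * chartShift i p.1 = (chartShift j x)⁻¹ * chartShift i x :=
      (continuous_fst.tendsto (x, v)).eventually (eventually_chartShift_eq hi hj)
    have h2 : ContinuousAt (fun p : CircleWedge × FreeGroup (Fin 2) =>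
        (chartShift j x)⁻¹ * chartShift i x * p.2) (x, v) :=
      (continuous_of_discreteTopology (f := fun w : FreeGroup (Fin 2) =>
        (chartShift j x)⁻¹ * chartShift i x * w)).continuousAt.comp continuousAt_snd
    refine h2.congr ?_
    filter_upwards [h1] with p hp
    rw [hp]
  coordChange_comp i j k x _ v := by group

theorem isCoveringMap_proj : IsCoveringMap coveringCore.proj :=
  FiberBundle.isCoveringMap (F := FreeGroup (Fin 2)) (E := coveringCore.Fiber)

theorem localTriv_symm_eq {i j : Bool} {x : CircleWedge} {v w : FreeGroup (Fin 2)}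
    (hj : coveringCore.indexAt x = j) (h : (chartShift j x)⁻¹ * chartShift i x * v = w) :
    (coveringCore.localTriv i).toOpenPartialHomeomorph.symm (x, v) =
      (⟨x, w⟩ : coveringCore.TotalSpace) := by
  subst hj h
  rfl

/-- The step function with value `v` up to `1 / 2` and `g * v` afterwards. -/
def liftSheet (v g : FreeGroup (Fin 2)) (t : I) : FreeGroup (Fin 2) :=
  if (t : ℝ) ≤ 1 / 2 then v else g * v

theorem liftSheet_of_le {v g : FreeGroup (Fin 2)} {t : I} (h : (t : ℝ) ≤ 1 / 2) :
    liftSheet v g t = v :=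
  if_pos h

theorem liftSheet_of_lt {v g : FreeGroup (Fin 2)} {t : I} (h : 1 / 2 < (t : ℝ)) :
    liftSheet v g t = g * v :=
  if_neg h.not_ge

/-- A lift of a path that crosses from the base point chart to the other chart and back. -/
theorem continuous_lift (γ : Path base base) (v g : FreeGroup (Fin 2))
    (h0 : ∀ t : I, (t : ℝ) ≠ 1 / 2 → γ t ∈ chart false)
    (hhalf : ∀ t : I, (t : ℝ) = 1 / 2 → γ t ∉ chart false)
    (h1 : ∀ t : I, 0 < (t : ℝ) → (t : ℝ) < 1 → γ t ∈ chart true)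
    (htr : ∀ t : I, 0 < (t : ℝ) → (t : ℝ) < 1 / 2 → transition (γ t) = 1)
    (htr' : ∀ t : I, 1 / 2 < (t : ℝ) → (t : ℝ) < 1 → transition (γ t) = g) :
    Continuous fun t : I =>
      (⟨γ t, liftSheet v g t⟩ : coveringCore.TotalSpace) := by
  have hsec : ∀ (i : Bool) (w : FreeGroup (Fin 2)) (t : I), γ t ∈ chart i →
      ContinuousAt (fun s : I => (coveringCore.localTriv i).toOpenPartialHomeomorph.symm
        (γ s, w)) t := by
    intro i w t ht
    refine ContinuousAt.comp (f := fun s : I => (γ s, w)) ?_ (by fun_prop)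
    exact OpenPartialHomeomorph.continuousAt_symm _
      ((coveringCore.mem_localTriv_target i (γ t, w)).2 ht)
  have hidx : ∀ t : I, (t : ℝ) ≠ 1 / 2 → coveringCore.indexAt (γ t) = false := fun t ht =>
    if_pos (h0 t ht)
  have hidx' : ∀ t : I, (t : ℝ) = 1 / 2 → coveringCore.indexAt (γ t) = true := fun t ht =>
    if_neg (hhalf t ht)
  have hcont : Continuous fun s : I => (s : ℝ) := continuous_subtype_val
  refine continuous_iff_continuousAt.2 fun t => ?_
  rcases lt_trichotomy (t : ℝ) (1 / 2) with ht | ht | ht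
  · refine (hsec false v t (h0 t ht.ne)).congr ?_
    filter_upwards [hcont.continuousAt.eventually_lt continuousAt_const ht] with s hs
    exact localTriv_symm_eq (hidx s hs.ne) (by rw [liftSheet_of_le hs.le]; simp)
  -- Near 1/2 the lift is the constant sheet v of the second chart. In the first chart this sheet
  -- reads v before 1/2 and g * v after it, which is the jump of `liftSheet`.
  · refine (hsec true v t (h1 t (by linarith) (by linarith))).congr ?_
    filter_upwards [hcont.continuousAt.eventually_lt continuousAt_const (by linarith : (t : ℝ) < 1),
      continuousAt_const.eventually_lt hcont.continuousAt (by linarith : 0 < (t : ℝ))] with s hs hs'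
    rcases lt_trichotomy (s : ℝ) (1 / 2) with h | h | h
    · exact localTriv_symm_eq (hidx s h.ne)
        (by rw [liftSheet_of_le h.le]; simp [chartShift, htr s hs' h])
    · exact localTriv_symm_eq (hidx' s h) (by rw [liftSheet_of_le h.le]; simp)
    · exact localTriv_symm_eq (hidx s h.ne')
        (by rw [liftSheet_of_lt h]; simp [chartShift, htr' s h hs])
  · refine (hsec false (g * v) t (h0 t ht.ne')).congr ?_
    filter_upwards [continuousAt_const.eventually_lt hcont.continuousAt ht] with s hs
    exact localTriv_symm_eq (hidx s hs.ne') (by rw [liftSheet_of_lt hs]; simp)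

/-- The points of the fibre over the base point. -/
def fiberPoint (v : FreeGroup (Fin 2)) : coveringCore.proj ⁻¹' {base} :=
  ⟨⟨base, v⟩, rfl⟩

theorem fiberPoint_injective : Function.Injective fiberPoint := by
  intro v w h
  exact eq_of_heq (Bundle.TotalSpace.mk.inj (congrArg Subtype.val h)).2

theorem monodromy_fiberPoint (γ : Path base base) (v g : FreeGroup (Fin 2))
    (h0 : ∀ t : I, (t : ℝ) ≠ 1 / 2 → γ t ∈ chart false)
    (hhalf : ∀ t : I, (t : ℝ) = 1 / 2 → γ t ∉ chart false)
    (h1 : ∀ t : I, 0 < (t : ℝ) → (t : ℝ) < 1 → γ t ∈ chart true)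
    (htr : ∀ t : I, 0 < (t : ℝ) → (t : ℝ) < 1 / 2 → transition (γ t) = 1)
    (htr' : ∀ t : I, 1 / 2 < (t : ℝ) → (t : ℝ) < 1 → transition (γ t) = g) :
    isCoveringMap_proj.monodromy (.mk γ) (fiberPoint v) = fiberPoint (g * v) := by
  let Γ : Path (fiberPoint v).1 (fiberPoint (g * v)).1 :=
    { toFun := _
      continuous_toFun := continuous_lift γ v g h0 hhalf h1 htr htr'
      source' := by
        rw [γ.source, liftSheet_of_le (by norm_num)]
        rfl
      target' := by
        rw [γ.target, liftSheet_of_lt (by norm_num)]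
        rfl }
  exact isCoveringMap_proj.monodromy_eq_of_map_eq (.mk Γ) rfl

theorem transition_inl_of_pos {z : Circle} (h : 0 < (z : ℂ).im) : transition (inl z) = 1 := by
  simp [transition, inl, h.not_gt]

theorem transition_inl_of_neg {z : Circle} (h : (z : ℂ).im < 0) :
    transition (inl z) = .of 0 := by
  simp [transition, inl, h]

theorem transition_inr_of_pos {z : Circle} (h : 0 < (z : ℂ).im) : transition (inr z) = 1 := by
  simp [transition, inr, h.not_gt]

theorem transition_inr_of_neg {z : Circle} (h : (z : ℂ).im < 0) :
    transition (inr z) = .of 1 := by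
  simp [transition, inr, h]

theorem monodromy_loopInl (v : FreeGroup (Fin 2)) :
    isCoveringMap_proj.monodromy (.mk loopInl) (fiberPoint v) = fiberPoint (.of 0 * v) := by
  apply monodromy_fiberPoint
  · exact fun t ht => ⟨stdLoop_ne_neg_one ht, one_ne_neg_one⟩
  · exact fun t ht h => h.1 (stdLoop_half ht)
  · exact fun t ht ht' => Or.inl (stdLoop_ne_one ht ht')
  · intro t ht ht'
    exact transition_inl_of_pos (stdLoop_im_pos ht ht')
  · intro t ht ht'
    exact transition_inl_of_neg (stdLoop_im_neg ht ht')

theorem monodromy_loopInr (v : FreeGroup (Fin 2)) :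
    isCoveringMap_proj.monodromy (.mk loopInr) (fiberPoint v) = fiberPoint (.of 1 * v) := by
  apply monodromy_fiberPoint
  · exact fun t ht => ⟨one_ne_neg_one, stdLoop_ne_neg_one ht⟩
  · exact fun t ht h => h.2 (stdLoop_half ht)
  · exact fun t ht ht' => Or.inr (stdLoop_ne_one ht ht')
  · intro t ht ht'
    exact transition_inr_of_pos (stdLoop_im_pos ht ht')
  · intro t ht ht'
    exact transition_inr_of_neg (stdLoop_im_neg ht ht')

/-- Coordinate changes are left multiplications, so words act on the fibre by left translation; the
image of `fiberPoint 1` then recovers the word. -/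
theorem monodromyPerm_freeHom (w v : FreeGroup (Fin 2)) :
    isCoveringMap_proj.monodromyPerm base (freeHom w) (fiberPoint v) = fiberPoint (w * v) := by
  induction w using FreeGroup.induction_on generalizing v with
  | C1 => rw [map_one, map_one, one_mul]; rfl
  | of i =>
    fin_cases i
    · exact (congrArg (fun γ => isCoveringMap_proj.monodromyPerm base γ (fiberPoint v))
        freeHom_of_zero).trans (monodromy_loopInl v)
    · exact (congrArg (fun γ => isCoveringMap_proj.monodromyPerm base γ (fiberPoint v))
        freeHom_of_one).trans (monodromy_loopInr v)
  | inv_of i ih =>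
    rw [map_inv, map_inv, Equiv.Perm.inv_eq_iff_eq, ih, mul_inv_cancel_left]
  | mul x y hx hy =>
    rw [map_mul, map_mul, Equiv.Perm.mul_apply, hy, hx, mul_assoc]

theorem freeHom_injective : Function.Injective freeHom := by
  refine (injective_iff_map_eq_one _).2 fun w hw => ?_
  have := monodromyPerm_freeHom w 1
  rw [hw, map_one, mul_one] at this
  exact (fiberPoint_injective this).symm

/-- The fundamental group of the wedge of two circles is free on the two standard loops. -/
def freeEquiv : FreeGroup (Fin 2) ≃* FundamentalGroup CircleWedge base :=
  MulEquiv.ofBijective freeHom ⟨freeHom_injective, freeHom_surjective⟩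

end CircleWedge
end

/-! ### The induced endomorphism and the failure of the Mittag-Leffler condition. -/

noncomputable section

open scoped unitInterval

namespace CircleWedge

section Quarters

variable {c₁ c₂ c₃ c₄ : Circle → CircleWedge} {t : I}

theorem onQuarters_stdLoop_first (h : (t : ℝ) ≤ 1 / 4) :
    onQuarters c₁ c₂ c₃ c₄ (Circle.stdLoop t) = c₁ (Circle.stdLoop t) := by
  have h0 := t.2.1
  have hpi := Real.pi_pos
  have him : 0 ≤ (Circle.stdLoop t : ℂ).im := by
    rw [stdLoop_im]
    apply Real.sin_nonneg_of_nonneg_of_le_pi <;> nlinarith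
  have hre : 0 ≤ (Circle.stdLoop t : ℂ).re := by
    rw [stdLoop_re]
    apply Real.cos_nonneg_of_mem_Icc
    constructor <;> nlinarith
  rw [onQuarters, if_pos him, if_pos hre]

theorem onQuarters_stdLoop_second (h : 1 / 4 < (t : ℝ)) (h' : (t : ℝ) ≤ 1 / 2) :
    onQuarters c₁ c₂ c₃ c₄ (Circle.stdLoop t) = c₂ (Circle.stdLoop t) := by
  have hpi := Real.pi_pos
  have him : 0 ≤ (Circle.stdLoop t : ℂ).im := by
    rw [stdLoop_im]
    apply Real.sin_nonneg_of_nonneg_of_le_pi <;> nlinarith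
  have hre : (Circle.stdLoop t : ℂ).re < 0 := by
    rw [stdLoop_re]
    apply Real.cos_neg_of_pi_div_two_lt_of_lt <;> nlinarith
  rw [onQuarters, if_pos him, if_neg hre.not_ge]

theorem onQuarters_stdLoop_third (h : 1 / 2 < (t : ℝ)) (h' : (t : ℝ) ≤ 3 / 4) :
    onQuarters c₁ c₂ c₃ c₄ (Circle.stdLoop t) = c₃ (Circle.stdLoop t) := by
  have hpi := Real.pi_pos
  have him := stdLoop_im_neg h (by linarith)
  have hre : (Circle.stdLoop t : ℂ).re ≤ 0 := by
    rw [stdLoop_re]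
    apply Real.cos_nonpos_of_pi_div_two_le_of_le <;> nlinarith
  rw [onQuarters, if_neg him.not_ge, if_pos hre]

theorem onQuarters_stdLoop_fourth (h : 3 / 4 < (t : ℝ)) (h' : (t : ℝ) < 1) :
    onQuarters c₁ c₂ c₃ c₄ (Circle.stdLoop t) = c₄ (Circle.stdLoop t) := by
  have hpi := Real.pi_pos
  have him := stdLoop_im_neg (by linarith) h'
  have hre : 0 < (Circle.stdLoop t : ℂ).re := by
    rw [stdLoop_re, ← Real.cos_sub_two_pi]
    apply Real.cos_pos_of_mem_Ioo
    constructor <;> nlinarith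
  rw [onQuarters, if_neg him.not_ge, if_neg hre.not_ge]

end Quarters

theorem bonding_inl (z : Circle) : bonding (inl z) =
    onQuarters (fun z => inl (z ^ 4)) (fun z => inr (z ^ 4))
      (fun z => inl (z ^ (-4 : ℤ))) (fun z => inr (z ^ (-4 : ℤ))) z :=
  if_pos rfl

theorem bonding_inr (z : Circle) : bonding (inr z) =
    onQuarters (fun t => inl (t ^ (-4 : ℤ))) (fun t => inr (t ^ (-4 : ℤ)))
      (fun t => inl (t ^ 4)) (fun t => inr (t ^ 4)) z := by
  by_cases h : z = 1
  · subst h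
    refine bonding_base.trans ?_
    simp [onQuarters, base, inl]
  · exact if_neg h

theorem stdLoop_pow_four {s t : I} (n : ℤ) (h : (s : ℝ) = 4 * t + n) :
    Circle.stdLoop t ^ 4 = Circle.stdLoop s := by
  rw [Circle.stdLoop_apply, Circle.stdLoop_apply, ← Circle.exp_nsmul, h]
  refine Eq.symm (Circle.exp_eq_exp.2 ⟨n, ?_⟩)
  rw [nsmul_eq_mul]
  push_cast
  ring

theorem stdLoop_zpow_neg_four {s t : I} (n : ℤ) (h : (s : ℝ) = -(4 * t) + n) :
    Circle.stdLoop t ^ (-4 : ℤ) = Circle.stdLoop s := by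
  rw [Circle.stdLoop_apply, Circle.stdLoop_apply, ← Circle.exp_zsmul, h]
  refine Eq.symm (Circle.exp_eq_exp.2 ⟨n, ?_⟩)
  rw [zsmul_eq_mul]
  push_cast
  ring

/-- This is an equality of paths, not only a homotopy: the balanced bracketing runs through each
factor in one quarter of the interval, as the fourth powers do. The integers passed below are the
numbers of full turns that separate the two parameters. -/
theorem map_loopInl : loopInl.map bonding.continuous =
    ((loopInl.trans loopInr).trans (loopInl.symm.trans loopInr.symm)).cast
      bonding_base bonding_base := by
  refine Path.ext (funext fun t => ?_)
  change bonding (inl (Circle.stdLoop t)) =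
    ((loopInl.trans loopInr).trans (loopInl.symm.trans loopInr.symm)) t
  -- The end t = 1 is separate, because `onQuarters` assigns the point 1 to the first quarter.
  rcases eq_or_lt_of_le t.2.2 with h1 | h1
  · have : t = 1 := Subtype.ext h1
    subst this
    rw [Path.target, Path.target]
    exact bonding_base
  rw [bonding_inl]
  simp only [Path.trans_apply]
  split_ifs with h h' h'
  · rw [onQuarters_stdLoop_first (by linarith)]
    exact congrArg inl (stdLoop_pow_four 0 (by push_cast; ring))
  · rw [onQuarters_stdLoop_second (by linarith) h]
    exact congrArg inr (stdLoop_pow_four (-1) (by push_cast; ring))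
  · rw [onQuarters_stdLoop_third (by linarith) (by linarith)]
    exact congrArg inl (stdLoop_zpow_neg_four 3 (by
      rw [unitInterval.coe_symm_eq]; push_cast; ring))
  · rw [onQuarters_stdLoop_fourth (by linarith) h1]
    exact congrArg inr (stdLoop_zpow_neg_four 4 (by
      rw [unitInterval.coe_symm_eq]; push_cast; ring))

theorem map_loopInr : loopInr.map bonding.continuous =
    ((loopInl.symm.trans loopInr.symm).trans (loopInl.trans loopInr)).cast
      bonding_base bonding_base := by
  refine Path.ext (funext fun t => ?_)
  change bonding (inr (Circle.stdLoop t)) =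
    ((loopInl.symm.trans loopInr.symm).trans (loopInl.trans loopInr)) t
  rcases eq_or_lt_of_le t.2.2 with h1 | h1
  · have : t = 1 := Subtype.ext h1
    subst this
    rw [Path.target, Path.target]
    exact bonding_base
  rw [bonding_inr]
  simp only [Path.trans_apply]
  split_ifs with h h' h'
  · rw [onQuarters_stdLoop_first (by linarith)]
    exact congrArg inl (stdLoop_zpow_neg_four 1 (by
      rw [unitInterval.coe_symm_eq]; push_cast; ring))
  · rw [onQuarters_stdLoop_second (by linarith) h]
    exact congrArg inr (stdLoop_zpow_neg_four 2 (by
      rw [unitInterval.coe_symm_eq]; push_cast; ring))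
  · rw [onQuarters_stdLoop_third (by linarith) (by linarith)]
    exact congrArg inl (stdLoop_pow_four (-2) (by push_cast; ring))
  · rw [onQuarters_stdLoop_fourth (by linarith) h1]
    exact congrArg inr (stdLoop_pow_four (-3) (by push_cast; ring))

theorem bondingHom_fromPath (γ δ : Path base base)
    (h : γ.map bonding.continuous = δ.cast bonding_base bonding_base) :
    bondingHom (FundamentalGroup.fromPath (.mk γ)) = FundamentalGroup.fromPath (.mk δ) := by
  refine (FundamentalGroup.mapOfEq_apply _ _ _).trans ?_
  refine (congrArg (fun p => Path.Homotopic.Quotient.cast (.mk p) _ _) h).trans ?_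
  rfl

/-- Multiplication in `FundamentalGroup` reverses concatenation, so the loop that runs through a, b,
a⁻¹, b⁻¹ in this order is the element b⁻¹a⁻¹ba. -/
theorem bondingHom_comp_freeHom :
    bondingHom.comp freeHom = freeHom.comp FreeGroup.commutatorEnd := by
  ext i
  fin_cases i
  · change bondingHom (freeHom (.of 0)) = freeHom (FreeGroup.commutatorEnd (.of 0))
    have : FreeGroup.commutatorEnd (.of 0) =
        (.of 1)⁻¹ * (.of 0)⁻¹ * (.of 1 * .of 0) := by simp [FreeGroup.commutatorEnd]
    rw [this]
    simp only [map_mul, map_inv, freeHom_of_zero, freeHom_of_one]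
    exact bondingHom_fromPath _ _ map_loopInl
  · change bondingHom (freeHom (.of 1)) = freeHom (FreeGroup.commutatorEnd (.of 1))
    have : FreeGroup.commutatorEnd (.of 1) =
        .of 1 * .of 0 * ((.of 1)⁻¹ * (.of 0)⁻¹) := by simp [FreeGroup.commutatorEnd]
    rw [this]
    simp only [map_mul, map_inv, freeHom_of_zero, freeHom_of_one]
    exact bondingHom_fromPath _ _ map_loopInr

theorem bondingHom_freeEquiv (w : FreeGroup (Fin 2)) :
    bondingHom (freeEquiv w) = freeEquiv (FreeGroup.commutatorEnd w) :=
  DFunLike.congr_fun bondingHom_comp_freeHom w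

theorem bondingHom_iterate_freeEquiv (n : ℕ) (w : FreeGroup (Fin 2)) :
    bondingHom^[n] (freeEquiv w) = freeEquiv (FreeGroup.commutatorEnd^[n] w) :=
  (Function.Semiconj.iterate_right (f := freeEquiv)
    (fun w => (bondingHom_freeEquiv w).symm) n w).symm

theorem bondingHom_iterate_ne_conj (m : ℕ) (c h : FundamentalGroup CircleWedge base) :
    bondingHom^[m] (freeEquiv (.of 0)) ≠ c * bondingHom^[m + 1] h * c⁻¹ := by
  obtain ⟨c, rfl⟩ := freeEquiv.surjective c
  obtain ⟨h, rfl⟩ := freeEquiv.surjective h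
  rw [bondingHom_iterate_freeEquiv, bondingHom_iterate_freeEquiv, ← map_inv, ← map_mul,
    ← map_mul]
  exact fun heq => FreeGroup.commutatorEnd_iterate_of_ne_conj m c h (freeEquiv.injective heq)

theorem bondingHom_injective : Function.Injective bondingHom := by
  intro x y h
  obtain ⟨x, rfl⟩ := freeEquiv.surjective x
  obtain ⟨y, rfl⟩ := freeEquiv.surjective y
  rw [bondingHom_freeEquiv, bondingHom_freeEquiv] at h
  exact congrArg _ (FreeGroup.commutatorEnd_injective (freeEquiv.injective h))

theorem bondingHom_iterate_notMem_range (m : ℕ) :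
    bondingHom^[m] (freeEquiv (.of 0)) ∉ Set.range bondingHom^[m + 1] := by
  rintro ⟨h, hh⟩
  exact bondingHom_iterate_ne_conj m 1 h (by rw [hh, one_mul, inv_one, mul_one])

theorem not_surjective_bondingHom : ¬ Function.Surjective bondingHom := fun h =>
  bondingHom_iterate_notMem_range 0 (h _)

theorem proGroup_map_apply (k : ℕ) (g : Opposite.op k ⟶ Opposite.op 0)
    (x : FundamentalGroup CircleWedge base) : (proGroup.map g).hom x = bondingHom^[k] x := by
  induction k generalizing x with
  | zero =>
    rw [Subsingleton.elim g (𝟙 _), proGroup.map_id]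
    rfl
  | succ k ih =>
    rw [Subsingleton.elim g ((homOfLE (Nat.le_add_right k 1)).op ≫ (homOfLE (Nat.zero_le k)).op),
      proGroup.map_comp, Function.iterate_succ_apply, ← ih (homOfLE (Nat.zero_le k)).op]
    exact congrArg (fun φ : proGroup.obj (.op (k + 1)) ⟶ proGroup.obj (.op k) =>
      (proGroup.map (homOfLE (Nat.zero_le k)).op).hom (φ.hom x))
      (Functor.ofOpSequence_map_homOfLE_succ
        (X := fun _ => GrpCat.of (FundamentalGroup CircleWedge base))
        (fun _ => GrpCat.ofHom bondingHom) k)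

/-- If the images in the group of index 0 were stable from m on, φ^m(a) would lie in the range of
φ^(m+1). -/
theorem not_isMittagLeffler_proGroup :
    ¬ (proGroup ⋙ forget GrpCat).IsMittagLeffler := by
  intro h
  obtain ⟨⟨m⟩, g, hg⟩ := h (.op 0)
  obtain ⟨y, hy⟩ := hg (homOfLE (Nat.zero_le (m + 1))).op ⟨freeEquiv (.of 0), rfl⟩
  exact bondingHom_iterate_notMem_range m
    ⟨y, ((proGroup_map_apply _ _ _).symm.trans hy).trans (proGroup_map_apply _ _ _)⟩

end CircleWedge
end

/-! ### Movability of a limit forces a homotopy factorization of an iterate. -/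

noncomputable section

open scoped unitInterval

/-- The complement is the projection of a closed set along a compact factor. -/
theorem isOpen_setOf_forall_mem {X K Y : Type*} [TopologicalSpace X] [TopologicalSpace K]
    [CompactSpace K] [TopologicalSpace Y] {φ : X × K → Y} (hφ : Continuous φ) {N : Set Y}
    (hN : IsOpen N) : IsOpen {x | ∀ t, φ (x, t) ∈ N} := by
  have h := isClosedMap_fst_of_compactSpace (X := X) (Y := K) _ (hN.preimage hφ).isClosed_compl
  convert h.isOpen_compl using 1
  ext x
  simp

section Segments

variable {V : Type*} [AddCommGroup V] [Module ℝ V]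

/-- The point of the segment from `p` to `q` with parameter `t`. -/
def segmentPoint (p q : V) (t : I) : V := (1 - t : ℝ) • p + (t : ℝ) • q

theorem segmentPoint_self (p : V) (t : I) : segmentPoint p p t = p := by
  rw [segmentPoint, ← add_smul, sub_add_cancel, one_smul]

variable [TopologicalSpace V] [ContinuousAdd V] [ContinuousSMul ℝ V]

theorem continuous_segmentPoint :
    Continuous fun x : (V × V) × I => segmentPoint x.1.1 x.1.2 x.2 := by
  unfold segmentPoint
  fun_prop

/-- Two maps into an open set with segments in this set stay homotopic after mapping the set to
another space. -/
theorem homotopic_of_segmentPoint_mem {Y B : Type*} [TopologicalSpace Y] [TopologicalSpace B]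
    {N : Set V} (r : C(N, B)) (p q : C(Y, V)) (h : ∀ y t, segmentPoint (p y) (q y) t ∈ N)
    {p' q' : C(Y, B)} (hp : ∀ y (hy : p y ∈ N), r ⟨p y, hy⟩ = p' y)
    (hq : ∀ y (hy : q y ∈ N), r ⟨q y, hy⟩ = q' y) : p'.Homotopic q' := by
  refine ⟨⟨⟨fun x => r ⟨segmentPoint (p x.2) (q x.2) x.1, h _ _⟩, ?_⟩, fun y => ?_, fun y => ?_⟩⟩
  · refine r.continuous.comp (Continuous.subtype_mk ?_ _)
    exact continuous_segmentPoint.comp (by fun_prop :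
      Continuous fun x : I × Y => ((p x.2, q x.2), x.1))
  · have h0 : segmentPoint (p y) (q y) 0 = p y := by simp [segmentPoint]
    have hy : p y ∈ N := h0 ▸ h y 0
    exact (congrArg r (Subtype.ext h0)).trans (hp y hy)
  · have h1 : segmentPoint (p y) (q y) 1 = q y := by simp [segmentPoint]
    have hy : q y ∈ N := h1 ▸ h y 1
    exact (congrArg r (Subtype.ext h1)).trans (hq y hy)

end Segments

/-- The iterates of a continuous self-map. -/
def ContinuousMap.iterateMap {X : Type*} [TopologicalSpace X] (f : C(X, X)) (n : ℕ) : C(X, X) :=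
  ⟨f^[n], f.continuous.iterate n⟩

section Movable

variable {B V : Type} [TopologicalSpace B] [CompactSpace B] [TopologicalSpace.MetrizableSpace B]
  [AddCommGroup V] [Module ℝ V] [TopologicalSpace V] [ContinuousAdd V] [ContinuousSMul ℝ V]
  [TietzeExtension.{0} V]

/-- The limit is the intersection of the decreasing compact sets of sequences that are compatible
below m, so one of these sets lies in O. It contains (f^m b, …, f b, b, b, …), where truncated
subtraction makes the tail constant. -/
theorem exists_iterate_mem (f : C(B, B)) {O : Set (ℕ → B)} (hO : IsOpen O)
    (h : ∀ x : SequentialLimit f, x.1 ∈ O) : ∃ m, ∀ b, (fun n => f^[m - n] b) ∈ O := by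
  let P : ℕ → Set (ℕ → B) := fun m => {x | ∀ n < m, f (x (n + 1)) = x n}
  have hanti : Antitone P := fun k l hkl x hx n hn => hx n (hn.trans_le hkl)
  have hclosed : ∀ m, IsClosed (P m) := by
    intro m
    have : P m = ⋂ n, ⋂ _ : n < m, {x : ℕ → B | f (x (n + 1)) = x n} := by
      ext x
      simp [P]
    rw [this]
    exact isClosed_iInter fun n => isClosed_iInter fun _ =>
      isClosed_eq (by fun_prop) (by fun_prop)
  obtain ⟨m, hm⟩ := exists_subset_nhds_of_compactSpace
    (directed_of_isDirected_le fun _ _ h => hanti h) hclosed (U := O) fun x hx =>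
      hO.mem_nhds (h ⟨x, fun n => Set.mem_iInter.1 hx (n + 1) n n.lt_succ_self⟩)
  refine ⟨m, fun b => hm fun n hn => ?_⟩
  rw [← Function.iterate_succ_apply' f]
  congr 2
  omega

/-- If the limit of `B ← B ← ⋯` is movable and `B` is a neighbourhood retract, then some iterate of
the bonding map factors up to homotopy through the next iterate. -/
theorem exists_homotopic_iterate_of_isMovable (f : C(B, B)) (i : C(B, V)) {N : Set V}
    (hN : IsOpen N) (hi : ∀ b, i b ∈ N) (r : C(N, B)) (hr : ∀ b, r ⟨i b, hi b⟩ = b)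
    (hmov : IsMovable (SequentialLimit f)) :
    ∃ m, ∃ g : C(B, B), (f.iterateMap m).Homotopic ((f.iterateMap (m + 1)).comp g) := by
  obtain ⟨e, he, hmov⟩ := hmov
  have hec : Topology.IsClosedEmbedding e := he.continuous.isClosedEmbedding he.injective
  -- Tietze extensions in both directions: `h n` extends the n-th coordinate to the cube, and `E`
  -- below extends the embedding to all sequences in B.
  have hext : ∀ n, ∃ h : C(HilbertCube, V), ∀ x : SequentialLimit f, h (e x) = i (x.1 n) := by
    intro n
    obtain ⟨h, hh⟩ := ContinuousMap.exists_extension' hec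
      (i.comp ⟨fun x => x.1 n, (continuous_apply n).comp continuous_subtype_val⟩ :
        C(SequentialLimit f, V))
    exact ⟨h, fun x => congrFun hh x⟩
  choose h hh using hext
  have hval : Topology.IsClosedEmbedding (Subtype.val : SequentialLimit f → ℕ → B) :=
    continuous_subtype_val.isClosedEmbedding Subtype.val_injective
  obtain ⟨E, hE⟩ := ContinuousMap.exists_extension' hval
    (⟨e, he.continuous⟩ : C(SequentialLimit f, HilbertCube))
  replace hE : ∀ x : SequentialLimit f, E x.1 = e x := fun x => congrFun hE x
  obtain ⟨V', hV'o, hXV', -, hW⟩ := hmov {y | h 0 y ∈ N} (hN.preimage (h 0).continuous) (by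
    rintro _ ⟨x, rfl⟩
    change h 0 (e x) ∈ N
    rw [hh]
    exact hi _)
  -- The index m depends only on the neighbourhood V' given by movability. The target W is chosen
  -- afterwards and may therefore depend on m.
  obtain ⟨m, hm⟩ := exists_iterate_mem f
    (O := {x | E x ∈ V'} ∩ {x | ∀ t, segmentPoint (h 0 (E x)) (i (x 0)) t ∈ N})
    ((hV'o.preimage E.continuous).inter (isOpen_setOf_forall_mem
      (φ := fun p : (ℕ → B) × I => segmentPoint (h 0 (E p.1)) (i (p.1 0)) p.2)
      (continuous_segmentPoint.comp (by fun_prop :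
        Continuous fun p : (ℕ → B) × I => ((h 0 (E p.1), i (p.1 0)), p.2))) hN))
    fun x => ⟨by
      change E x.1 ∈ V'
      rw [hE]
      exact hXV' ⟨x, rfl⟩, fun t => by
      rw [hE, hh, segmentPoint_self]
      exact hi _⟩
  let D : Set HilbertCube := {y | h (m + 1) y ∈ N}
  let ρ : C(D, B) := r.comp ⟨fun y => ⟨h (m + 1) y.1, y.2⟩, by fun_prop⟩
  -- On the limit the coordinate 0 is f^(m+1) of the coordinate m + 1. The set W' consists of the
  -- points where the extended coordinates satisfy this up to a segment in N.
  let W' : Set D := {y | ∀ t, segmentPoint (h 0 y.1) (i (f.iterateMap (m + 1) (ρ y))) t ∈ N}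
  have hDo : IsOpen D := hN.preimage (h (m + 1)).continuous
  have hW'o : IsOpen W' := isOpen_setOf_forall_mem
    (φ := fun p : D × I => segmentPoint (h 0 p.1.1) (i (f.iterateMap (m + 1) (ρ p.1))) p.2)
    (continuous_segmentPoint.comp (by fun_prop :
      Continuous fun p : D × I =>
        ((h 0 p.1.1, i (f.iterateMap (m + 1) (ρ p.1))), p.2))) hN
  have hiter : ∀ (x : SequentialLimit f) n, f^[n] (x.1 n) = x.1 0 := by
    intro x n
    induction n with
    | zero => rfl
    | succ n ih => rw [Function.iterate_succ_apply, x.2, ih]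
  obtain ⟨F, hF⟩ := hW (Subtype.val '' W') (hDo.isOpenMap_subtype_val _ hW'o) (by
    rintro _ ⟨x, rfl⟩
    have hx : h (m + 1) (e x) ∈ N := by rw [hh]; exact hi _
    refine ⟨⟨e x, hx⟩, fun t => ?_, rfl⟩
    have h1 : ρ ⟨e x, hx⟩ = x.1 (m + 1) :=
      (congrArg r (Subtype.ext (hh (m + 1) x))).trans (hr _)
    have h2 : f.iterateMap (m + 1) (x.1 (m + 1)) = x.1 0 := hiter x (m + 1)
    rw [h1, h2, hh, segmentPoint_self]
    exact hi _)
  let S : C(B, V') := ⟨fun b => ⟨E fun n => f^[m - n] b, (hm b).1⟩, by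
    refine Continuous.subtype_mk (E.continuous.comp (continuous_pi fun n => ?_)) _
    exact f.continuous.iterate _⟩
  have hFD : ∀ b, (F (S b, 1)).1 ∈ D := fun b => by
    obtain ⟨y, -, hy⟩ := (hF (S b)).2
    rw [← hy]
    exact y.2
  -- Send b into V' by `S`, deform it into W, and read off the coordinate m + 1. Coordinate 0 along
  -- the deformation gives f^m ≃ `a 0` ≃ `a 1` ≃ f^(m+1) ∘ g.
  let g : C(B, B) := ρ.comp ⟨fun b => ⟨(F (S b, 1)).1, hFD b⟩, by fun_prop⟩
  let a : I → C(B, B) := fun t => r.comp ⟨fun b => ⟨h 0 (F (S b, t)).1, (F (S b, t)).2⟩, by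
    fun_prop⟩
  have H1 : (a 0).Homotopic (f.iterateMap m) := by
    refine homotopic_of_segmentPoint_mem r (((h 0).comp E).comp
      ⟨fun b n => f^[m - n] b, continuous_pi fun n => f.continuous.iterate _⟩)
      (i.comp (f.iterateMap m)) (fun b t => (hm b).2 t) (fun b hb => ?_) (fun b hb => hr _)
    exact congrArg r (Subtype.ext (congrArg (h 0) (hF (S b)).1.symm))
  have H2 : (a 0).Homotopic (a 1) :=
    ⟨⟨⟨fun x => r ⟨h 0 (F (S x.2, x.1)).1, (F (S x.2, x.1)).2⟩, by fun_prop⟩,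
      fun _ => rfl, fun _ => rfl⟩⟩
  have H3 : (a 1).Homotopic ((f.iterateMap (m + 1)).comp g) := by
    refine homotopic_of_segmentPoint_mem r
      ((h 0).comp ⟨fun b => (F (S b, 1)).1, by fun_prop⟩)
      (i.comp ((f.iterateMap (m + 1)).comp g)) (fun b t => ?_) (fun b hb => rfl)
      (fun b hb => hr _)
    obtain ⟨y, hy, hy'⟩ := (hF (S b)).2
    have : y = ⟨(F (S b, 1)).1, hFD b⟩ := Subtype.ext hy'
    subst this
    exact hy t
  exact ⟨m, g, (H1.symm.trans H2).trans H3⟩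

end Movable
end

/-! ### The wedge as a neighbourhood retract, and non-movability. -/

noncomputable section

open scoped unitInterval

namespace CircleWedge
open Complex

/-- The inclusion of the wedge in `ℂ × ℂ`. -/
def toComplexProd : C(CircleWedge, ℂ × ℂ) := ⟨fun x => (x.1.1, x.1.2), by fun_prop⟩

/-- An open neighbourhood of the wedge in `ℂ × ℂ` that retracts to the wedge. -/
def retractDomain : Set (ℂ × ℂ) :=
  {p | (‖p.1 - 1‖ < 1 ∨ ‖p.2 - 1‖ < 1) ∧
    shrinkIm ‖p.2 - 1‖ p.1 ≠ 0 ∧ shrinkIm ‖p.1 - 1‖ p.2 ≠ 0}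

theorem continuous_shrinkIm_fst :
    Continuous fun p : ℂ × ℂ => shrinkIm ‖p.2 - 1‖ p.1 :=
  continuous_shrinkIm.comp (by fun_prop : Continuous fun p : ℂ × ℂ => (‖p.2 - 1‖, p.1))

theorem continuous_shrinkIm_snd :
    Continuous fun p : ℂ × ℂ => shrinkIm ‖p.1 - 1‖ p.2 :=
  continuous_shrinkIm.comp (by fun_prop : Continuous fun p : ℂ × ℂ => (‖p.1 - 1‖, p.2))

theorem isOpen_retractDomain : IsOpen retractDomain :=
  ((isOpen_lt (by fun_prop : Continuous fun p : ℂ × ℂ => ‖p.1 - 1‖) continuous_const).union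
    (isOpen_lt (by fun_prop : Continuous fun p : ℂ × ℂ => ‖p.2 - 1‖) continuous_const)).inter
    ((isOpen_ne_fun continuous_shrinkIm_fst continuous_const).inter
      (isOpen_ne_fun continuous_shrinkIm_snd continuous_const))

/-- This makes the retraction land in the wedge: the coordinate nearer to 1 is shrunk by at least
its own imaginary part and becomes 1. On the wedge itself one distance is 0, so the other coordinate
stays fixed. -/
theorem toCircle_shrinkIm_of_norm_le {z : ℂ} {d : ℝ} (h : ‖z - 1‖ ≤ d) (h1 : ‖z - 1‖ < 1) :
    toCircle (shrinkIm d z) = 1 := by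
  apply toCircle_shrinkIm
  · simpa using (abs_im_le_norm (z - 1)).trans h
  · have := (abs_re_le_norm (z - 1)).trans_lt h1
    rw [sub_re, one_re, abs_lt] at this
    linarith [this.1]

/-- The retraction of the neighbourhood to the wedge. -/
def wedgeRetraction : C(retractDomain, CircleWedge) where
  toFun p := ⟨(toCircle (shrinkIm ‖p.1.2 - 1‖ p.1.1), toCircle (shrinkIm ‖p.1.1 - 1‖ p.1.2)), by
    obtain ⟨⟨z, w⟩, h, -⟩ := p
    rcases le_total ‖z - 1‖ ‖w - 1‖ with hle | hle
    · exact Or.inr (toCircle_shrinkIm_of_norm_le hle (h.elim id hle.trans_lt))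
    · exact Or.inl (toCircle_shrinkIm_of_norm_le hle (h.elim hle.trans_lt id))⟩
  continuous_toFun := by
    refine Continuous.subtype_mk (Continuous.prodMk ?_ ?_) _
    · exact continuous_toCircle_comp (continuous_shrinkIm_fst.comp continuous_subtype_val)
        fun p => p.2.2.1
    · exact continuous_toCircle_comp (continuous_shrinkIm_snd.comp continuous_subtype_val)
        fun p => p.2.2.2

theorem shrinkIm_norm_one_sub {z : ℂ} : shrinkIm ‖z - 1‖ 1 = 1 := by
  rw [shrinkIm_of_abs_le (by simp), one_re, ofReal_one]

theorem toComplexProd_mem (x : CircleWedge) : toComplexProd x ∈ retractDomain := by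
  obtain ⟨⟨z, w⟩, h⟩ := x
  rcases h with h | h <;> dsimp only at h <;> subst h
  · refine ⟨Or.inr (by simp [toComplexProd]), ?_, ?_⟩
    · simp [toComplexProd, shrinkIm_zero]
    · simp [toComplexProd, shrinkIm_norm_one_sub]
  · refine ⟨Or.inl (by simp [toComplexProd]), ?_, ?_⟩
    · simp [toComplexProd, shrinkIm_norm_one_sub]
    · simp [toComplexProd, shrinkIm_zero]

theorem toCircle_one : toCircle 1 = 1 := by
  simpa using toCircle_coe 1

theorem wedgeRetraction_toComplexProd (x : CircleWedge) :
    wedgeRetraction ⟨toComplexProd x, toComplexProd_mem x⟩ = x := by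
  obtain ⟨⟨z, w⟩, h⟩ := x
  apply Subtype.ext
  rcases h with h | h <;> dsimp only at h <;> subst h
  · simp [wedgeRetraction, toComplexProd, shrinkIm_zero, shrinkIm_norm_one_sub, toCircle_coe,
      toCircle_one]
  · simp [wedgeRetraction, toComplexProd, shrinkIm_zero, shrinkIm_norm_one_sub, toCircle_coe,
      toCircle_one]

theorem joined_base (x : CircleWedge) : Joined base x := by
  obtain ⟨⟨z, w⟩, h⟩ := x
  have hc : ∀ z : Circle, Joined 1 z := fun z =>
    ⟨{  toFun := fun t => Circle.exp (t * arg z)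
        source' := by simp
        target' := by simp [Circle.exp_arg] }⟩
  rcases h with h | h <;> dsimp only at h <;> subst h
  · exact (hc z).map continuous_inl
  · exact (hc w).map continuous_inr

theorem iterateMap_base (n : ℕ) : bonding.iterateMap n base = base :=
  Function.iterate_fixed bonding_base n

theorem bondingHom_iterate (n : ℕ) (p : Path.Homotopic.Quotient base base) :
    bondingHom^[n] (FundamentalGroup.fromPath p) = FundamentalGroup.fromPath
      ((p.map (bonding.iterateMap n)).cast (iterateMap_base n).symm (iterateMap_base n).symm) := by
  obtain ⟨p, rfl⟩ := Path.Homotopic.Quotient.mk_surjective p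
  induction n generalizing p with
  | zero => rfl
  | succ n ih =>
    have hstep : bondingHom (FundamentalGroup.fromPath (.mk p)) = FundamentalGroup.fromPath
        (.mk ((p.map bonding.continuous).cast bonding_base.symm bonding_base.symm)) :=
      FundamentalGroup.mapOfEq_apply _ _ _
    rw [Function.iterate_succ_apply, hstep, ih]
    rfl

/-- If loops at `y₀` and `y₂` are conjugate by a path, the same holds for loops at points from
which there are paths to these points. -/
theorem exists_conj_of_trans_eq {X : Type*} [TopologicalSpace X] {b y₀ y₁ y₂ : X} (h₀ : b = y₀)
    (h₁ : b = y₁) (p : Path.Homotopic.Quotient y₀ y₀) (q : Path.Homotopic.Quotient y₂ y₂)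
    (c : Path.Homotopic.Quotient y₀ y₂) (d : Path.Homotopic.Quotient y₁ y₂)
    (h : p.trans c = c.trans q) :
    ∃ k : FundamentalGroup X b, FundamentalGroup.fromPath (p.cast h₀ h₀) =
      k * FundamentalGroup.fromPath ((d.trans (q.trans d.symm)).cast h₁ h₁) * k⁻¹ := by
  subst h₀ h₁
  refine ⟨(FundamentalGroup.fromPath (c.trans d.symm))⁻¹, ?_⟩
  rw [inv_inv, Path.Homotopic.Quotient.cast_rfl_rfl, Path.Homotopic.Quotient.cast_rfl_rfl]
  rw [mul_assoc, eq_inv_mul_iff_mul_eq]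
  change p.trans (c.trans d.symm) = (c.trans d.symm).trans (d.trans (q.trans d.symm))
  rw [← Path.Homotopic.Quotient.trans_assoc, h]
  simp only [Path.Homotopic.Quotient.trans_assoc]
  rw [← Path.Homotopic.Quotient.trans_assoc d.symm d, Path.Homotopic.Quotient.symm_trans,
    Path.Homotopic.Quotient.refl_trans]

/-- The homotopy need not fix the base point, and g need not preserve it. The track of the base
point and a path from it to its image under g turn the homotopy into a conjugacy between φ^m(a) and
an element of the range of φ^(m+1). -/
theorem not_homotopic_iterateMap (m : ℕ) (g : C(CircleWedge, CircleWedge)) :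
    ¬ (bonding.iterateMap m).Homotopic ((bonding.iterateMap (m + 1)).comp g) := by
  rintro ⟨H⟩
  obtain ⟨δ⟩ := joined_base (g base)
  let d : Path.Homotopic.Quotient base (g base) := .mk δ
  let q : Path.Homotopic.Quotient (g base) (g base) := (Path.Homotopic.Quotient.mk loopInl).map g
  let G := bonding.iterateMap (m + 1)
  have hnat : ((Path.Homotopic.Quotient.mk loopInl).map (bonding.iterateMap m)).trans
      (.mk (H.evalAt base)) = Path.Homotopic.Quotient.trans (.mk (H.evalAt base)) (q.map G) :=
    Path.Homotopic.Quotient.eq.2 (Path.Homotopic.map_trans_evalAt H loopInl)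
  obtain ⟨k, hk⟩ := exists_conj_of_trans_eq (iterateMap_base m).symm
    (iterateMap_base (m + 1)).symm _ _ _ (d.map G) hnat
  refine bondingHom_iterate_ne_conj m k
    (FundamentalGroup.fromPath (d.trans (q.trans d.symm))) ?_
  have h0 : freeEquiv (.of 0) = FundamentalGroup.fromPath (.mk loopInl) := freeHom_of_zero
  rw [h0, bondingHom_iterate, bondingHom_iterate, hk]
  have hmap : (d.trans (q.trans d.symm)).map G =
      (d.map G).trans ((q.map G).trans (d.map G).symm) := by
    rw [map_trans, map_trans]
    rfl
  rw [hmap]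

theorem not_isMovable_sequentialLimit : ¬ IsMovable (SequentialLimit bonding) := fun h => by
  obtain ⟨m, g, hg⟩ := exists_homotopic_iterate_of_isMovable bonding toComplexProd
    isOpen_retractDomain toComplexProd_mem wedgeRetraction wedgeRetraction_toComplexProd h
  exact not_homotopic_iterateMap m g hg

end CircleWedge
end

theorem proposition2 :
    ¬ IsMovable (SequentialLimit CircleWedge.bonding) ∧
    Nonempty (FundamentalGroup CircleWedge CircleWedge.base ≃* FreeGroup (Fin 2)) ∧
    Function.Injective CircleWedge.bondingHom ∧
    ¬ Function.Surjective CircleWedge.bondingHom ∧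
    ¬ (CircleWedge.proGroup ⋙ forget GrpCat).IsMittagLeffler :=
  ⟨CircleWedge.not_isMovable_sequentialLimit, ⟨CircleWedge.freeEquiv.symm⟩,
    CircleWedge.bondingHom_injective, CircleWedge.not_surjective_bondingHom,
    CircleWedge.not_isMittagLeffler_proGroup⟩
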